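/- Let $k$ be an algebraically closed field, $R=k[x,y,z]$ with its standard grading, and let $0\neq f\in R$ be a homogeneous polynomial of degree $d+1$ such that $\operatorname{char}(k)$ does not divide $d+1$ and the ideal $(f)$ is radical. Assume that the reduced curve $X=V(f)\subset\mathbb P^2_k$ is singular. Let $J_f=(f_x,f_y,f_z)$, let $\mathrm{Syz}(J_f)=\{(a,b,c)\in R^3 : af_x+bf_y+cf_z=0\}$, graded as a submodule of $R^3$, and let $e=\mathrm{indeg}(\mathrm{Syz}(J_f))$ be the least degree of a nonzero homogeneous element of $\mathrm{Syz}(J_f)$. For a nonzero homogeneous $\epsilon\in\mathrm{Syz}(J_f)$ of degree $e$, a Bourbaki ideal $I_\epsilon$ is a homogeneous ideal of $R$ that fits into an exact sequence of graded $R$-modules $0\to R(-e)\xrightarrow{\ \epsilon\ }\mathrm{Syz}(J_f)\to I_\epsilon(e-d)\to 0$ and that has codimension two if $\mathrm{Syz}(J_f)$ is not free, and is equal to $R$ if $\mathrm{Syz}(J_f)$ is free. The Bourbaki degree $\mathrm{Bour}(X)$ is the degree (multiplicity) of $R/I_\epsilon$, which does not depend on the choices; it is $0$ if $\mathrm{Syz}(J_f)$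 is free. Then $\mathrm{Bour}(X)=2$ if and only if $R/J_f$ has a minimal graded free resolution of the form $$0\to R(-(2d-e+3))\to R(-(2d-e+2))\oplus R(-(2d-e+1))\oplus R(-(d+e))\to R(-d)^3\to R\to R/J_f\to 0 .$$ Moreover, in this case $e\le (d+1)/2$. -/

import Mathlib

open MvPolynomial

noncomputable section

namespace PlaneCurve

/-- The standard graded polynomial ring `R = k[x, y, z]`. -/
abbrev PolyRing (k : Type*) [Field k] := MvPolynomial (Fin 3) k

variable {k : Type*} [Field k]

/-- The graded piece `R_j` of `R`, for an arbitrary integer `j` (zero for `j < 0`). -/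
def piece (k : Type*) [Field k] (j : ℤ) : Submodule k (PolyRing k) :=
  if 0 ≤ j then homogeneousSubmodule (Fin 3) k j.toNat else ⊥

/-- The degree `j` piece of the graded free module `⊕ᵢ R(-aᵢ)`, whose `i`-th component
is `R_{j - aᵢ}`. -/
def freePiece {n : ℕ} (a : Fin n → ℤ) (j : ℤ) : Submodule k (Fin n → PolyRing k) :=
  Submodule.pi Set.univ fun i => piece k (j - a i)

/-- The irrelevant maximal ideal `(x, y, z)`. -/
def irrelevantIdeal (k : Type*) [Field k] : Ideal (PolyRing k) :=
  Ideal.span (Set.range X)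

/-! ### Curves, gradient ideals and syzygies -/

/-- The projective plane curve `V(f)` is singular: `f` and its partial derivatives have a
common zero in the projective plane. -/
def IsSingular (f : PolyRing k) : Prop :=
  ∃ p : Fin 3 → k, p ≠ 0 ∧ eval p f = 0 ∧ ∀ i, eval p (pderiv i f) = 0

/-- The gradient ideal `J_f = (f_x, f_y, f_z)`. -/
def gradientIdeal (f : PolyRing k) : Ideal (PolyRing k) :=
  Ideal.span (Set.range fun i => pderiv i f)

/-- The module `Syz(J_f)` of triples `(a, b, c)` with `a f_x + b f_y + c f_z = 0`, as a
submodule of `R³` (generators of `R³` in degree `0`). -/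
def syz (f : PolyRing k) : Submodule (PolyRing k) (Fin 3 → PolyRing k) :=
  LinearMap.ker (Fintype.linearCombination (PolyRing k) fun i => pderiv i f)

/-- `f` is a free divisor: `Syz(J_f)` is a free module. -/
def IsFreeDivisor (f : PolyRing k) : Prop :=
  Module.Free (PolyRing k) (syz f)

/-- The initial degree of `Syz(J_f)`: the least `n` such that `Syz(J_f)_n ≠ 0`. -/
def indegSyz (f : PolyRing k) : ℕ :=
  sInf {n : ℕ | ∃ v ∈ syz f, v ≠ 0 ∧ v ∈ freePiece (k := k) (0 : Fin 3 → ℤ) n}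

/-! ### The degree (multiplicity) of a graded quotient `R/I` -/

/-- The Hilbert function `n ↦ dim_k (R/I)_n`. -/
def hilbertFunction (I : Ideal (PolyRing k)) (n : ℕ) : ℕ :=
  Module.finrank k
    ((homogeneousSubmodule (Fin 3) k n).map (Ideal.Quotient.mkₐ k I).toLinearMap)

open Classical in
/-- The Hilbert polynomial of `R/I`: the polynomial that agrees with the Hilbert function
in all large degrees. It is unique, and it exists for every homogeneous `I`. -/
def hilbertPolynomial (I : Ideal (PolyRing k)) : Polynomial ℚ :=
  if h : ∃ P : Polynomial ℚ,
      ∀ᶠ n : ℕ in Filter.atTop, (hilbertFunction I n : ℚ) = P.eval (n : ℚ)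
  then h.choose else 0

open Classical in
/-- The degree (algebraic multiplicity) of `R/I`. If the Hilbert polynomial is nonzero, of
degree `r` and with leading coefficient `c`, it is `r! c`; if it is zero, that is, if `R/I` has
finite length, it is that length (in particular it is `0` for `I = R`). -/
def degQuot (I : Ideal (PolyRing k)) : ℚ :=
  if hilbertPolynomial I = 0 then (Module.finrank k (PolyRing k ⧸ I) : ℚ)
  else ((hilbertPolynomial I).natDegree.factorial : ℚ) * (hilbertPolynomial I).leadingCoeff

/-! ### Bourbaki ideals and the Bourbaki degree -/

attribute [local instance] MvPolynomial.gradedAlgebra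

/-- `I` is a Bourbaki ideal `I_ε` of the curve `V(f)` of degree `d + 1`, with respect to the
homogeneous syzygy `ε` of degree `e`: there is a graded exact sequence
`0 → R(-e) → Syz(J_f) → I(e - d) → 0` whose first map is given by `ε`, where `I` is a homogeneous
ideal, equal to `R` if `f` is a free divisor, and of codimension two (hence proper)
otherwise. -/
structure IsBourbakiIdeal (d e : ℕ) (f : PolyRing k) (ε : syz f) (I : Ideal (PolyRing k)) :
    Prop where
  homogeneous : I.IsHomogeneous (homogeneousSubmodule (Fin 3) k)
  eq_top : IsFreeDivisor f → I = ⊤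
  height_eq_two : ¬ IsFreeDivisor f → I.height = 2
  exists_sequence : ∃ u : syz f →ₗ[PolyRing k] PolyRing k,
    LinearMap.ker u = Submodule.span (PolyRing k) {ε} ∧
    LinearMap.range u = I ∧
    ∀ (j : ℤ) (w : syz f), (w : Fin 3 → PolyRing k) ∈ freePiece (k := k) (0 : Fin 3 → ℤ) j →
      u w ∈ piece k (j + (e - d))

/-- The Bourbaki degree of the curve `V(f)` of degree `d + 1`: the degree of `R/I_ε`, where `I_ε`
is a Bourbaki ideal with respect to a minimal generator `ε` of `Syz(J_f)` of initial degree, that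
is, a nonzero homogeneous element whose degree is the initial degree. (The degree of
`R/I_ε` depends neither on `ε` nor on `I_ε`, so that the set below has exactly one element.) -/
def bourbakiDegree (d : ℕ) (f : PolyRing k) : ℕ :=
  sInf {n : ℕ | ∃ (ε : syz f) (I : Ideal (PolyRing k)),
    ε ≠ 0 ∧ (ε : Fin 3 → PolyRing k) ∈ freePiece (k := k) (0 : Fin 3 → ℤ) (indegSyz f) ∧
    IsBourbakiIdeal d (indegSyz f) f ε I ∧ degQuot I = n}

/-! ### Minimal graded free resolutions -/

/-- A linear map `⊕ᵢ R(-aᵢ) → ⊕ⱼ R(-bⱼ)` is graded, i.e. homogeneous of degree `0`. -/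
def IsGradedMap {m n : ℕ} (a : Fin m → ℤ) (b : Fin n → ℤ)
    (φ : (Fin m → PolyRing k) →ₗ[PolyRing k] (Fin n → PolyRing k)) : Prop :=
  ∀ j : ℤ, ∀ v ∈ freePiece (k := k) a j, φ v ∈ freePiece (k := k) b j

/-- The image of the map lies in `(x, y, z)` times the target. -/
def IsMinimalMap {m n : ℕ}
    (φ : (Fin m → PolyRing k) →ₗ[PolyRing k] (Fin n → PolyRing k)) : Prop :=
  LinearMap.range φ ≤ irrelevantIdeal k • (⊤ : Submodule (PolyRing k) (Fin n → PolyRing k))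

/-- `R/I` has a minimal graded free resolution of the form
`0 → ⊕ R(-a₃ᵢ) → ⊕ R(-a₂ᵢ) → ⊕ R(-a₁ᵢ) → ⊕ R(-a₀ᵢ) → R/I → 0`. -/
def HasMinimalGradedFreeResolution (I : Ideal (PolyRing k)) {n₀ n₁ n₂ n₃ : ℕ}
    (a₀ : Fin n₀ → ℤ) (a₁ : Fin n₁ → ℤ) (a₂ : Fin n₂ → ℤ) (a₃ : Fin n₃ → ℤ) : Prop :=
  ∃ (π : (Fin n₀ → PolyRing k) →ₗ[PolyRing k] PolyRing k ⧸ I)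
    (φ₁ : (Fin n₁ → PolyRing k) →ₗ[PolyRing k] (Fin n₀ → PolyRing k))
    (φ₂ : (Fin n₂ → PolyRing k) →ₗ[PolyRing k] (Fin n₁ → PolyRing k))
    (φ₃ : (Fin n₃ → PolyRing k) →ₗ[PolyRing k] (Fin n₂ → PolyRing k)),
    (∀ j : ℤ, ∀ v ∈ freePiece (k := k) a₀ j,
      π v ∈ (piece k j).map (Ideal.Quotient.mkₐ k I).toLinearMap) ∧
    IsGradedMap a₁ a₀ φ₁ ∧ IsGradedMap a₂ a₁ φ₂ ∧ IsGradedMap a₃ a₂ φ₃ ∧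
    Function.Surjective π ∧ Function.Exact φ₁ π ∧ Function.Exact φ₂ φ₁ ∧
    Function.Exact φ₃ φ₂ ∧ Function.Injective φ₃ ∧
    IsMinimalMap φ₁ ∧ IsMinimalMap φ₂ ∧ IsMinimalMap φ₃

end PlaneCurve

end

/-!
Plane curves of Bourbaki degree two.

Let `Syz = Syz(J_f)`, let `ε` be a nonzero syzygy of minimal degree `e`, and let
`0 → R(-e) → Syz → I(e - d) → 0` be the sequence of a Bourbaki ideal `I`.

Suppose that `I` has degree two. Then `f` is not a free divisor, so `I` has height two. As `Syz` is
the kernel of a map `R³ → R`, the ideal `I` is saturated with respect to `(x, y, z)`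
(`mem_range_of_forall_X_mul_mem`). Hence some linear form is a nonzerodivisor on `R/I`, and the
Hilbert function of `R/I` is nondecreasing. It is bounded because `I` contains two coprime
homogeneous polynomials, so it becomes constant, equal to the degree two, and must be `1, 2, 2, …`.
It follows that `I = (q, l)` with `q` a quadratic and `l` a linear form, coprime to each other
(`exists_eq_span_of_degQuot_eq_two`). Lifts of `q` and `l` to `Syz` have degrees `d - e + 2` and
`d - e + 1`; together with `ε` they generate `Syz`, with a single relation that lifts the Koszul
relation between `q` and `l`. This is the resolution (`IsBourbakiIdeal.resolution`). It is minimal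
since `e > 0` and `e ≤ d - e + 1`; the latter holds as the lift of `l` is a nonzero syzygy, and
gives the bound on `e`.

Conversely, a resolution of this form presents `Syz` by generators `g₀, g₁, g₂` of degrees
`d - e + 2`, `d - e + 1`, `e` and a single relation `(r₀, r₁, r₂)` with coefficients in `(x, y, z)`
(`exists_syzPresentation`). Therefore `Syz` is not free. The submodule generated by `g₂` is
saturated in `Syz` because the degree of `g₂` is minimal, and this forces `r₀`, `r₁` to be coprime.
Then `v ↦ v₀ r₁ - v₁ r₀` induces an isomorphism of `Syz / (g₂)` with the height two ideal
`(r₀, r₁)`, so that Bourbaki ideals exist (`SyzPresentation.isBourbakiIdeal`). Finally, every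
Bourbaki ideal is generated by forms of degrees two and one, so it is a complete intersection of
degree two (`SyzPresentation.degQuot_eq_two`).
-/

noncomputable section

namespace PlaneCurve

attribute [local instance] MvPolynomial.gradedAlgebra

variable {k : Type*} [Field k]

/-! ### Homogeneous components in integral degrees -/

theorem mem_piece_natCast {n : ℕ} {p : PolyRing k} :
    p ∈ piece k (n : ℤ) ↔ p.IsHomogeneous n := by
  simp [piece]

theorem mem_piece_of_eq {i j : ℤ} (h : i = j) {p : PolyRing k} (hp : p ∈ piece k i) :
    p ∈ piece k j := h ▸ hp

theorem eq_zero_of_mem_piece_neg {j : ℤ} (hj : j < 0) {p : PolyRing k} (hp : p ∈ piece k j) :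
    p = 0 := by
  simpa [piece, not_le.mpr hj] using hp

theorem nonneg_of_mem_piece {j : ℤ} {p : PolyRing k} (hp : p ∈ piece k j) (h : p ≠ 0) : 0 ≤ j := by
  by_contra hj
  exact h (eq_zero_of_mem_piece_neg (not_le.mp hj) hp)

theorem isHomogeneous_of_mem_piece {j : ℤ} {p : PolyRing k} (hp : p ∈ piece k j) :
    p.IsHomogeneous j.toNat := by
  by_cases hj : 0 ≤ j
  · simpa [piece, hj] using hp
  · rw [eq_zero_of_mem_piece_neg (not_le.mp hj) hp]
    exact isHomogeneous_zero _ _ _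

theorem mul_mem_piece {i j : ℤ} {p q : PolyRing k} (hp : p ∈ piece k i) (hq : q ∈ piece k j) :
    p * q ∈ piece k (i + j) := by
  rcases eq_or_ne p 0 with rfl | hp0
  · simp
  rcases eq_or_ne q 0 with rfl | hq0
  · simp
  lift i to ℕ using nonneg_of_mem_piece hp hp0
  lift j to ℕ using nonneg_of_mem_piece hq hq0
  rw [mem_piece_natCast] at hp hq
  rw [← Nat.cast_add, mem_piece_natCast]
  exact hp.mul hq

theorem exists_C_of_mem_piece_zero {p : PolyRing k} (hp : p ∈ piece k 0) : ∃ c : k, p = C c := by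
  have h : p ∈ homogeneousSubmodule (Fin 3) k 0 := by simpa [piece] using hp
  rw [homogeneousSubmodule_zero, Submodule.mem_one] at h
  obtain ⟨c, hc⟩ := h
  exact ⟨c, hc.symm⟩

theorem C_mem_piece_zero (c : k) : (C c : PolyRing k) ∈ piece k 0 := by
  have := (isHomogeneous_C (Fin 3) c)
  exact (mem_piece_natCast (n := 0)).2 this

theorem mem_irrelevantIdeal_iff {p : PolyRing k} :
    p ∈ irrelevantIdeal k ↔ coeff 0 p = 0 := by
  have h := mem_ideal_span_X_image (x := p) (s := Set.univ)
  rw [irrelevantIdeal, ← Set.image_univ, h]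
  constructor
  · intro hm
    by_contra h0
    obtain ⟨i, -, hi⟩ := hm 0 (mem_support_iff.2 h0)
    simp at hi
  · intro h0 m hm
    by_contra! hne
    have : m = 0 := by ext i; simpa using hne i (Set.mem_univ i)
    rw [this] at hm
    exact (mem_support_iff.1 hm) h0

theorem one_notMem_irrelevantIdeal : (1 : PolyRing k) ∉ irrelevantIdeal k := by
  simp [mem_irrelevantIdeal_iff]

theorem mem_irrelevantIdeal_of_mem_piece {j : ℤ} (hj : 0 < j) {p : PolyRing k}
    (hp : p ∈ piece k j) : p ∈ irrelevantIdeal k := by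
  rw [mem_irrelevantIdeal_iff]
  refine (isHomogeneous_of_mem_piece hp).coeff_eq_zero ?_
  simp; omega

/-- The homogeneous component of integral degree `j` of a polynomial (zero for `j < 0`). -/
def intComponent (j : ℤ) : PolyRing k →ₗ[k] PolyRing k :=
  if 0 ≤ j then homogeneousComponent j.toNat else 0

theorem intComponent_mem (j : ℤ) (p : PolyRing k) : intComponent j p ∈ piece k j := by
  by_cases hj : 0 ≤ j
  · simpa [intComponent, piece, hj] using homogeneousComponent_isHomogeneous j.toNat p
  · simp [intComponent, piece, hj]

theorem intComponent_of_mem {j : ℤ} {p : PolyRing k} (hp : p ∈ piece k j) :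
    intComponent j p = p := by
  by_cases hj : 0 ≤ j
  · simp only [intComponent, piece, hj, if_true] at hp ⊢
    rw [homogeneousComponent_of_mem hp, if_pos rfl]
  · simp only [intComponent, piece, hj, if_false, Submodule.mem_bot] at hp ⊢
    simp [hp]

theorem intComponent_of_mem_ne {i j : ℤ} (hij : i ≠ j) {p : PolyRing k} (hp : p ∈ piece k i) :
    intComponent j p = 0 := by
  by_cases hj : 0 ≤ j
  · by_cases hi : 0 ≤ i
    · simp only [intComponent, piece, hj, hi, if_true] at hp ⊢
      rw [homogeneousComponent_of_mem hp, if_neg (by omega)]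
    · simp [eq_zero_of_mem_piece_neg (not_le.mp hi) hp]
  · simp [intComponent, hj]

theorem intComponent_eq_zero_of_notMem_image {p : PolyRing k} {j : ℤ}
    (hj : j ∉ (Finset.range (p.totalDegree + 1)).image (fun n : ℕ => (n : ℤ))) :
    intComponent j p = 0 := by
  by_cases h : 0 ≤ j
  · simp only [intComponent, h, if_true]
    refine homogeneousComponent_eq_zero _ _ ?_
    by_contra hlt
    exact hj (Finset.mem_image.2 ⟨j.toNat, Finset.mem_range.2 (by omega), by omega⟩)
  · simp [intComponent, h]

theorem exists_intComponent_eq_zero (p : PolyRing k) :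
    ∃ S : Finset ℤ, ∀ j ∉ S, intComponent j p = 0 :=
  ⟨_, fun _ hj => intComponent_eq_zero_of_notMem_image hj⟩

theorem sum_intComponent {p : PolyRing k} {S : Finset ℤ} (hS : ∀ j ∉ S, intComponent j p = 0) :
    ∑ j ∈ S, intComponent j p = p := by
  classical
  set T := (Finset.range (p.totalDegree + 1)).image (fun n : ℕ => (n : ℤ)) with hT
  have h1 : ∑ j ∈ S, intComponent j p = ∑ j ∈ S ∪ T, intComponent j p :=
    Finset.sum_subset Finset.subset_union_left fun j _ hj => hS j hj
  have h2 : ∑ j ∈ T, intComponent j p = ∑ j ∈ S ∪ T, intComponent j p :=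
    Finset.sum_subset Finset.subset_union_right fun j _ hj =>
      intComponent_eq_zero_of_notMem_image hj
  rw [h1, ← h2, hT, Finset.sum_image (fun _ _ _ _ h => by exact_mod_cast h)]
  simp only [intComponent, Nat.cast_nonneg, if_true, Int.toNat_natCast]
  exact sum_homogeneousComponent p

/-- Taking components commutes with an additive map that respects the gradings. `P` and `Q` are the
projections to the components of source and target, and the finite set `S` contains the degrees in
which `w` has a nonzero component. -/
theorem component_map {M N : Type*} [AddCommGroup M] [AddCommGroup N] (T : M →+ N)
    (P : ℤ → M → M) (Q : ℤ → N →+ N) {w : M} {S : Finset ℤ} (hS : ∑ j ∈ S, P j w = w)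
    (hS' : ∀ j ∉ S, P j w = 0) (h1 : ∀ j, Q j (T (P j w)) = T (P j w))
    (h2 : ∀ i j, i ≠ j → Q j (T (P i w)) = 0) (j : ℤ) : Q j (T w) = T (P j w) := by
  conv_lhs => rw [← hS]
  rw [map_sum, map_sum]
  by_cases hj : j ∈ S
  · rw [Finset.sum_eq_single_of_mem j hj fun i _ hij => h2 i j hij, h1]
  · rw [hS' j hj, map_zero]
    exact Finset.sum_eq_zero fun i hi => h2 i j fun h => hj (h ▸ hi)

theorem intComponent_mul {i : ℤ} {q : PolyRing k} (hq : q ∈ piece k i) (p : PolyRing k) (j : ℤ) :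
    intComponent (j + i) (p * q) = intComponent j p * q := by
  obtain ⟨S, hS⟩ := exists_intComponent_eq_zero p
  refine component_map (AddMonoidHom.mulRight q) (fun j p => intComponent j p)
    (fun j => (intComponent (k := k) (j + i)).toAddMonoidHom) (sum_intComponent hS) hS ?_ ?_ j
  · intro j
    exact intComponent_of_mem (mul_mem_piece (intComponent_mem j p) hq)
  · intro a b hab
    exact intComponent_of_mem_ne (i := a + i) (by omega)
      (mul_mem_piece (intComponent_mem a p) hq)

/-! ### Components of elements of graded free modules -/

theorem mem_freePiece {n : ℕ} {a : Fin n → ℤ} {j : ℤ} {v : Fin n → PolyRing k} :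
    v ∈ freePiece a j ↔ ∀ i, v i ∈ piece k (j - a i) := by
  simp [freePiece]

/-- The component of degree `j` of an element of the graded free module `⊕ᵢ R(-aᵢ)`. -/
def vecComponent {n : ℕ} (a : Fin n → ℤ) (j : ℤ) :
    (Fin n → PolyRing k) →ₗ[k] (Fin n → PolyRing k) :=
  LinearMap.pi fun i => intComponent (j - a i) ∘ₗ LinearMap.proj i

@[simp]
theorem vecComponent_apply {n : ℕ} (a : Fin n → ℤ) (j : ℤ) (v : Fin n → PolyRing k) (i : Fin n) :
    vecComponent a j v i = intComponent (j - a i) (v i) := rfl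

theorem vecComponent_mem {n : ℕ} (a : Fin n → ℤ) (j : ℤ) (v : Fin n → PolyRing k) :
    vecComponent a j v ∈ freePiece a j :=
  mem_freePiece.2 fun i => intComponent_mem (j - a i) (v i)

theorem exists_vecComponent_eq_zero {n : ℕ} (a : Fin n → ℤ) (v : Fin n → PolyRing k) :
    ∃ S : Finset ℤ, ∀ j ∉ S, vecComponent a j v = 0 := by
  choose S hS using fun i => exists_intComponent_eq_zero (v i)
  refine ⟨Finset.univ.biUnion fun i => (S i).image (· + a i), fun j hj => funext fun i => ?_⟩
  refine hS i _ fun h => hj ?_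
  exact Finset.mem_biUnion.2 ⟨i, Finset.mem_univ _, Finset.mem_image.2 ⟨_, h, by omega⟩⟩

theorem sum_vecComponent {n : ℕ} {a : Fin n → ℤ} {v : Fin n → PolyRing k} {S : Finset ℤ}
    (hS : ∀ j ∉ S, vecComponent a j v = 0) : ∑ j ∈ S, vecComponent a j v = v := by
  classical
  funext i
  rw [Finset.sum_apply]
  have h : ∀ j ∉ S.image (· - a i), intComponent j (v i) = 0 := by
    intro j hj
    have := congrFun (hS (j + a i) fun h => hj (Finset.mem_image.2 ⟨_, h, by omega⟩)) i
    simpa using this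
  have := sum_intComponent h
  rw [Finset.sum_image (fun _ _ _ _ h => by simpa using h)] at this
  exact this

/-- A graded linear map on a graded submodule of a graded free module commutes with components. -/
theorem map_vecComponent {n : ℕ} {a : Fin n → ℤ} {W : Submodule (PolyRing k) (Fin n → PolyRing k)}
    (hW : ∀ j, ∀ v ∈ W, vecComponent a j v ∈ W) (u : W →ₗ[PolyRing k] PolyRing k) {c : ℤ}
    (hu : ∀ (j : ℤ) (w : W), (w : Fin n → PolyRing k) ∈ freePiece a j → u w ∈ piece k (j + c))
    (w : W) (j : ℤ) :
    u ⟨vecComponent a j w, hW j w w.2⟩ = intComponent (j + c) (u w) := by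
  obtain ⟨S, hS⟩ := exists_vecComponent_eq_zero a (w : Fin n → PolyRing k)
  refine (component_map u.toAddMonoidHom (fun j (w : W) => ⟨vecComponent a j w, hW j w w.2⟩)
    (fun j => (intComponent (k := k) (j + c)).toAddMonoidHom) (S := S) ?_ ?_ ?_ ?_ j).symm
  · ext1
    rw [AddSubmonoidClass.coe_finsetSum]
    exact sum_vecComponent hS
  · intro j hj
    ext1
    exact hS j hj
  · intro j
    exact intComponent_of_mem (hu j _ (vecComponent_mem a j (w : Fin n → PolyRing k)))
  · intro i j hij
    exact intComponent_of_mem_ne (i := i + c) (by omega)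
      (hu i _ (vecComponent_mem a i (w : Fin n → PolyRing k)))

/-- `Syz(J_f)` is a graded submodule of `R³`. -/
theorem vecComponent_mem_syz {f : PolyRing k} {d : ℕ} (hf : f.IsHomogeneous (d + 1)) (j : ℤ)
    {v : Fin 3 → PolyRing k} (hv : v ∈ syz f) : vecComponent (0 : Fin 3 → ℤ) j v ∈ syz f := by
  have hd : ∀ i, pderiv i f ∈ piece k (d : ℤ) := fun i => mem_piece_natCast.2 hf.pderiv
  rw [syz, LinearMap.mem_ker, Fintype.linearCombination_apply] at hv ⊢
  have := congrArg (intComponent (k := k) (j + d)) hv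
  rw [map_sum, map_zero] at this
  simpa [intComponent_mul (hd _)] using this

/-! ### Hilbert functions -/

instance finite_homogeneousSubmodule (n : ℕ) :
    Module.Finite k (homogeneousSubmodule (Fin 3) k n) :=
  Module.Finite.iff_fg.2 (homogeneousSubmodule_fg (Fin 3) k n)

instance finite_piece (j : ℤ) : Module.Finite k (piece k j) := by
  by_cases h : 0 ≤ j
  · have h1 : piece k j = homogeneousSubmodule (Fin 3) k j.toNat := by simp [piece, h]
    rw [h1]
    infer_instance
  · have h1 : piece k j = ⊥ := by simp [piece, h]
    rw [h1]
    infer_instance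

theorem finrank_homogeneousSubmodule (n : ℕ) :
    Module.finrank k (homogeneousSubmodule (Fin 3) k n) = (n + 2).choose 2 := by
  rw [homogeneousSubmodule_eq_finsupp_supported]
  have h : {d : Fin 3 →₀ ℕ | d.degree = n} =
      ((Finset.univ : Finset (Fin 3)).finsuppAntidiag n : Set (Fin 3 →₀ ℕ)) := by
    ext d
    simp [Finset.mem_finsuppAntidiag, Finsupp.degree_eq_sum]
  rw [h, LinearEquiv.finrank_eq (AddMonoidAlgebra.supportedEquivFinsupp _),
    Module.finrank_finsupp_self]
  simp only [Finset.coe_sort_coe, Fintype.card_coe]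
  rw [Finset.card_finsuppAntidiag_nat_eq_choose]
  rw [Finset.card_univ, Fintype.card_fin, show 3 + n - 1 = n + 2 by omega]
  exact Nat.choose_symm_add

/-- `dim R_j = (j + 1)(j + 2) / 2`, which also holds for `j = -1` and `j = -2`. -/
theorem two_mul_finrank_piece {j : ℤ} (hj : -2 ≤ j) :
    2 * (Module.finrank k (piece k j) : ℤ) = (j + 1) * (j + 2) := by
  by_cases h : 0 ≤ j
  · lift j to ℕ using h
    have : piece k (j : ℤ) = homogeneousSubmodule (Fin 3) k j := by simp [piece]
    rw [this, finrank_homogeneousSubmodule]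
    have h3 := Nat.choose_two_right (j + 2)
    have h4 : 2 ∣ (j + 2) * (j + 2 - 1) := by
      simpa using (Nat.even_mul_pred_self (j + 2)).two_dvd
    obtain ⟨c, hc⟩ := h4
    rw [h3, hc, Nat.mul_div_cancel_left _ two_pos]
    have h5 : j + 2 - 1 = j + 1 := by omega
    rw [h5] at hc
    zify at hc
    linarith
  · have : piece k j = ⊥ := by simp [piece, h]
    rw [this, finrank_bot]
    have : j = -1 ∨ j = -2 := by omega
    rcases this with rfl | rfl <;> norm_num

theorem hilbertFunction_add_finrank (I : Ideal (PolyRing k)) (n : ℕ) :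
    hilbertFunction I n +
        Module.finrank k (I.restrictScalars k ⊓ homogeneousSubmodule (Fin 3) k n :
          Submodule k (PolyRing k)) =
      Module.finrank k (homogeneousSubmodule (Fin 3) k n) := by
  set W := homogeneousSubmodule (Fin 3) k n
  set q := (Ideal.Quotient.mkₐ k I).toLinearMap
  have h := LinearMap.finrank_range_add_finrank_ker (q.domRestrict W)
  rw [← h, LinearMap.range_domRestrict]
  congr 1
  have hk : (I.restrictScalars k ⊓ W : Submodule k (PolyRing k)) =
      (LinearMap.ker (q.domRestrict W)).map W.subtype := by
    ext p
    simp only [Submodule.mem_inf, Submodule.restrictScalars_mem, Submodule.mem_map,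
      LinearMap.mem_ker, LinearMap.domRestrict_apply, Submodule.subtype_apply, Subtype.exists,
      exists_and_left, exists_prop, q, AlgHom.toLinearMap_apply, Ideal.Quotient.mkₐ_eq_mk,
      Ideal.Quotient.eq_zero_iff_mem]
    constructor
    · rintro ⟨h1, h2⟩
      exact ⟨p, h1, h2, rfl⟩
    · rintro ⟨p, h1, h2, rfl⟩
      exact ⟨h1, h2⟩
  rw [hk]
  exact Submodule.finrank_map_subtype_eq W _

theorem hilbertFunction_anti {I J : Ideal (PolyRing k)} (h : I ≤ J) (n : ℕ) :
    hilbertFunction J n ≤ hilbertFunction I n := by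
  have h1 := hilbertFunction_add_finrank I n
  have h2 := hilbertFunction_add_finrank J n
  have h3 : Module.finrank k (I.restrictScalars k ⊓ homogeneousSubmodule (Fin 3) k n :
        Submodule k (PolyRing k)) ≤ Module.finrank k
      (J.restrictScalars k ⊓ homogeneousSubmodule (Fin 3) k n : Submodule k (PolyRing k)) :=
    Submodule.finrank_mono (inf_le_inf_right _ h)
  omega

/-- Ideals `I ≤ J` with the same Hilbert function in degree `n` agree in that degree. -/
theorem mem_of_hilbertFunction_eq {I J : Ideal (PolyRing k)} (h : I ≤ J) {n : ℕ}
    (hn : hilbertFunction I n = hilbertFunction J n) {p : PolyRing k} (hp : p ∈ J)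
    (hpn : p.IsHomogeneous n) : p ∈ I := by
  have h1 := hilbertFunction_add_finrank I n
  have h2 := hilbertFunction_add_finrank J n
  have h3 : (I.restrictScalars k ⊓ homogeneousSubmodule (Fin 3) k n : Submodule k (PolyRing k)) =
      J.restrictScalars k ⊓ homogeneousSubmodule (Fin 3) k n :=
    Submodule.eq_of_le_of_finrank_eq (inf_le_inf_right _ h) (by omega)
  have h4 : p ∈ (J.restrictScalars k ⊓ homogeneousSubmodule (Fin 3) k n :
      Submodule k (PolyRing k)) := ⟨hp, hpn⟩
  rw [← h3] at h4
  exact h4.1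

/-- The Hilbert function of a complete intersection of two curves of degrees `a` and `b` takes the
value `ab` in all degrees `n ≥ a + b - 2`: the relations between `f` and `g` are generated
by `g · f - f · g = 0`. -/
theorem hilbertFunction_span_pair {f g : PolyRing k} {a b n : ℕ} (hf : f.IsHomogeneous a)
    (hg : g.IsHomogeneous b) (hf0 : f ≠ 0) (hfg : IsRelPrime f g) (hn : a + b ≤ n + 2) :
    hilbertFunction (Ideal.span {f, g}) n = a * b := by
  rw [← mem_piece_natCast] at hf hg
  let T : (piece k ((n : ℤ) - a) × piece k ((n : ℤ) - b)) →ₗ[k] PolyRing k :=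
    LinearMap.coprod (LinearMap.mulRight k f ∘ₗ Submodule.subtype _)
      (LinearMap.mulRight k g ∘ₗ Submodule.subtype _)
  have hT : ∀ s, T s = s.1 * f + s.2 * g := fun s => rfl
  let K : piece k ((n : ℤ) - a - b) →ₗ[k] (piece k ((n : ℤ) - a) × piece k ((n : ℤ) - b)) :=
    LinearMap.prod
      ((LinearMap.mulRight k g ∘ₗ Submodule.subtype _).codRestrict _ fun r => by
        have := mul_mem_piece r.2 hg
        rwa [sub_add_cancel] at this)
      ((LinearMap.mulRight k (-f) ∘ₗ Submodule.subtype _).codRestrict _ fun r => by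
        have := mul_mem_piece r.2 (neg_mem hf)
        have e : (n : ℤ) - a - b + a = n - b := by ring
        rwa [e] at this)
  have hK : ∀ r, ((K r).1 : PolyRing k) = r * g ∧ ((K r).2 : PolyRing k) = r * (-f) :=
    fun r => ⟨rfl, rfl⟩
  have hKinj : Function.Injective K := by
    intro r s h
    have h2 : ((K r).2 : PolyRing k) = (K s).2 := by rw [h]
    rw [(hK r).2, (hK s).2] at h2
    exact Subtype.ext (mul_right_cancel₀ (neg_ne_zero.2 hf0) h2)
  have hker : LinearMap.range K = LinearMap.ker T := by
    ext ⟨s, t⟩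
    rw [LinearMap.mem_ker, hT, LinearMap.mem_range]
    constructor
    · rintro ⟨r, hr⟩
      rw [← hr, (hK r).1, (hK r).2]
      ring
    · intro h
      have h1 : f ∣ t * g := ⟨-s, by linear_combination h⟩
      obtain ⟨r, hr⟩ := hfg.dvd_of_dvd_mul_right h1
      have hs : (s : PolyRing k) = -r * g := by
        refine mul_right_cancel₀ hf0 ?_
        rw [hr] at h
        linear_combination h
      refine ⟨⟨intComponent ((n : ℤ) - a - b) (-r), intComponent_mem _ _⟩, ?_⟩
      refine Prod.ext (Subtype.ext ?_) (Subtype.ext ?_)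
      · rw [(hK _).1]
        have := intComponent_mul hg (-r) ((n : ℤ) - a - b)
        rw [sub_add_cancel, ← hs, intComponent_of_mem s.2] at this
        exact this.symm
      · rw [(hK _).2]
        have := intComponent_mul (neg_mem hf) (-r) ((n : ℤ) - a - b)
        have e : (n : ℤ) - a - b + a = n - b := by ring
        rw [e, neg_mul_neg, mul_comm r f, ← hr, intComponent_of_mem t.2] at this
        exact this.symm
  have hrange : LinearMap.range T = (Ideal.span {f, g}).restrictScalars k ⊓
      homogeneousSubmodule (Fin 3) k n := by
    ext p
    rw [LinearMap.mem_range, Submodule.mem_inf, Submodule.restrictScalars_mem,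
      mem_homogeneousSubmodule, ← mem_piece_natCast, Ideal.mem_span_pair]
    constructor
    · rintro ⟨s, rfl⟩
      rw [hT]
      refine ⟨⟨_, _, rfl⟩, add_mem ?_ ?_⟩
      · simpa using mul_mem_piece s.1.2 hf
      · simpa using mul_mem_piece s.2.2 hg
    · rintro ⟨⟨s, t, h⟩, hp⟩
      refine ⟨(⟨intComponent _ s, intComponent_mem _ _⟩,
        ⟨intComponent _ t, intComponent_mem _ _⟩), ?_⟩
      rw [hT]
      dsimp only
      rw [← intComponent_mul hf, ← intComponent_mul hg, sub_add_cancel, sub_add_cancel, ← map_add,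
        h, intComponent_of_mem hp]
  have h1 := LinearMap.finrank_range_add_finrank_ker T
  rw [hrange, ← hker, LinearMap.finrank_range_of_inj hKinj, Module.finrank_prod] at h1
  have h2 := hilbertFunction_add_finrank (Ideal.span {f, g}) n
  have h3 : piece k (n : ℤ) = homogeneousSubmodule (Fin 3) k n := by simp [piece]
  rw [← h3] at h1 h2
  have e0 := two_mul_finrank_piece (k := k) (j := n) (by omega)
  have e1 := two_mul_finrank_piece (k := k) (j := (n : ℤ) - a - b) (by omega)
  have e2 := two_mul_finrank_piece (k := k) (j := (n : ℤ) - a) (by omega)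
  have e3 := two_mul_finrank_piece (k := k) (j := (n : ℤ) - b) (by omega)
  zify at h1 h2 ⊢
  have h4 : 2 * (hilbertFunction (Ideal.span {f, g}) n : ℤ) = 2 * (a * b) := by
    linear_combination 2 * h2 - 2 * h1 + e0 - e2 - e3 + e1
  linarith

theorem hilbertPolynomial_eq_C {I : Ideal (PolyRing k)} {c : ℕ}
    (h : ∀ᶠ n : ℕ in Filter.atTop, hilbertFunction I n = c) :
    hilbertPolynomial I = Polynomial.C (c : ℚ) := by
  have hex : ∃ P : Polynomial ℚ,
      ∀ᶠ n : ℕ in Filter.atTop, (hilbertFunction I n : ℚ) = P.eval (n : ℚ) :=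
    ⟨Polynomial.C (c : ℚ), h.mono fun n hn => by simp [hn]⟩
  rw [hilbertPolynomial, dif_pos hex]
  refine Polynomial.eq_of_infinite_eval_eq _ _ ?_
  obtain ⟨N, hN⟩ := Filter.eventually_atTop.1 (hex.choose_spec.and h)
  refine Set.Infinite.mono (s := (fun n : ℕ => (n : ℚ)) '' Set.Ici N) ?_
    ((Set.Ici_infinite N).image fun _ _ _ _ h => by exact_mod_cast h)
  rintro _ ⟨n, hn, rfl⟩
  obtain ⟨h1, h2⟩ := hN n hn
  rw [Set.mem_ofPred_eq, ← h1, h2, Polynomial.eval_C]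

theorem degQuot_of_hilbertFunction {I : Ideal (PolyRing k)} {c : ℕ} (hc : c ≠ 0)
    (h : ∀ᶠ n : ℕ in Filter.atTop, hilbertFunction I n = c) : degQuot I = c := by
  rw [degQuot, hilbertPolynomial_eq_C h, if_neg (by simpa using hc), Polynomial.natDegree_C,
    Polynomial.leadingCoeff_C]
  simp

theorem degQuot_top : degQuot (⊤ : Ideal (PolyRing k)) = 0 := by
  have hH : ∀ n, hilbertFunction (⊤ : Ideal (PolyRing k)) n = 0 := fun n =>
    Module.finrank_zero_of_subsingleton
  have hP : hilbertPolynomial (⊤ : Ideal (PolyRing k)) = 0 := by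
    rw [hilbertPolynomial_eq_C (c := 0) (Filter.Eventually.of_forall hH), Nat.cast_zero,
      Polynomial.C_0]
  rw [degQuot, if_pos hP, Module.finrank_zero_of_subsingleton, Nat.cast_zero]

/-! ### Avoiding finitely many subspaces -/

/-- A subspace over an infinite field is not covered by finitely many subspaces that do not
contain it. -/
theorem _root_.Submodule.exists_mem_forall_notMem {ι E : Type*} [Infinite k] [AddCommGroup E]
    [Module k E] (W : Submodule k E) (s : Finset ι) (V : ι → Submodule k E)
    (h : ∀ i ∈ s, ¬ W ≤ V i) : ∃ w ∈ W, ∀ i ∈ s, w ∉ V i := by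
  classical
  have hs : (⊤ : Submodule k W) ∉ s.image fun i => (V i).comap W.subtype := by
    intro ht
    obtain ⟨i, hi, hti⟩ := Finset.mem_image.1 ht
    refine h i hi fun w hw => ?_
    have : (⟨w, hw⟩ : W) ∈ (V i).comap W.subtype := hti ▸ Submodule.mem_top
    exact this
  have := Subspace.biUnion_ne_univ_of_top_notMem hs
  rw [Set.ne_univ_iff_exists_notMem] at this
  obtain ⟨w, hw⟩ := this
  refine ⟨w, w.2, fun i hi hwi => hw ?_⟩
  simp only [Set.mem_iUnion, exists_prop]
  exact ⟨_, Finset.mem_image_of_mem _ hi, hwi⟩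

/-! ### Ideals of height two -/

theorem not_le_span_of_height_eq_two {R : Type*} [CommRing R] [IsNoetherianRing R] {I : Ideal R}
    (hI : I.height = 2) {p : R} (hp : ¬ IsUnit p) : ¬ I ≤ Ideal.span {p} := by
  intro h
  have := (Ideal.height_mono h).trans (Ideal.height_span_singleton_le_one hp)
  rw [hI] at this
  exact absurd this (by decide)

theorem isRelPrime_of_height_span_pair {R : Type*} [CommRing R] [IsNoetherianRing R] {a b : R}
    (h : (Ideal.span {a, b}).height = 2) : IsRelPrime a b := by
  intro d hda hdb
  by_contra hd
  refine not_le_span_of_height_eq_two h hd (Ideal.span_le.2 ?_)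
  rintro x (rfl | rfl)
  · exact Ideal.mem_span_singleton.2 hda
  · exact Ideal.mem_span_singleton.2 hdb

theorem height_span_pair {R : Type*} [CommRing R] [IsDomain R] [IsNoetherianRing R]
    [UniqueFactorizationMonoid R] {a b : R} (ha : a ≠ 0) (hab : IsRelPrime a b)
    (ht : Ideal.span {a, b} ≠ ⊤) : (Ideal.span {a, b}).height = 2 := by
  refine le_antisymm ?_ ?_
  · obtain ⟨P, hP⟩ := Ideal.nonempty_minimalPrimes ht
    refine (Ideal.height_mono hP.1.2).trans ?_
    refine (Ideal.height_le_card_of_mem_minimalPrimes_span (Set.toFinite _) hP).trans ?_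
    exact_mod_cast (Set.ncard_insert_le a {b}).trans (by simp)
  · rw [Ideal.height_eq_inf_minimalPrimes]
    refine le_iInf₂ fun P hP => ?_
    have hPp : P.IsPrime := hP.1.1
    have haP : a ∈ P := hP.1.2 (Ideal.subset_span (by simp))
    have hbP : b ∈ P := hP.1.2 (Ideal.subset_span (by simp))
    obtain ⟨p, hpP, hp⟩ := hPp.exists_mem_prime_of_ne_bot
      (fun h => ha (by simpa [h] using haP))
    have hpp : (Ideal.span {p}).IsPrime := (Ideal.span_singleton_prime hp.ne_zero).2 hp
    have h1 : (Ideal.span {p}) < P := by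
      refine lt_of_le_of_ne ((Ideal.span_singleton_le_iff_mem _).2 hpP) fun h => hp.not_isUnit ?_
      rw [← h, Ideal.mem_span_singleton] at haP hbP
      exact hab haP hbP
    have h2 : (⊥ : Ideal R) < Ideal.span {p} := by
      rw [bot_lt_iff_ne_bot, Ne, Ideal.span_singleton_eq_bot]
      exact hp.ne_zero
    have h3 := Ideal.height_add_one_le_of_lt_of_isPrime h1
    have h4 := Ideal.height_add_one_le_of_lt_of_isPrime h2
    calc (2 : ℕ∞) = 0 + 1 + 1 := by norm_num
      _ ≤ (Ideal.span {p}).height + 1 := by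
          gcongr
          exact le_trans (by gcongr; exact zero_le) h4
      _ ≤ P.height := h3

theorem exists_isHomogeneous_notMem {I : Ideal (PolyRing k)}
    (hI : I.IsHomogeneous (homogeneousSubmodule (Fin 3) k)) {J : Ideal (PolyRing k)}
    (h : ¬ I ≤ J) : ∃ (n : ℕ) (g : PolyRing k), g ∈ I ∧ g.IsHomogeneous n ∧ g ∉ J := by
  obtain ⟨p, hp, hpJ⟩ := SetLike.not_le_iff_exists.1 h
  by_contra! hne
  refine hpJ ?_
  rw [← sum_homogeneousComponent p]
  exact sum_mem fun n _ => hne n _ (homogeneousComponent_mem_of_mem hI hp n)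
    (homogeneousComponent_isHomogeneous n p)

theorem exists_not_dvd_X {p : PolyRing k} (hp : Prime p) :
    ∃ i : Fin 3, ¬ p ∣ X i := by
  by_contra! h
  have h01 : (X 0 : PolyRing k) ∣ X 1 :=
    (hp.irreducible.dvd_symm (X_prime (R := k)).irreducible (h 0)).trans (h 1)
  simp [X_dvd_X] at h01

/-- Homogeneous prime avoidance: a homogeneous ideal of height two contains two coprime
homogeneous polynomials. -/
theorem exists_isRelPrime_of_height_eq_two [Infinite k] {I : Ideal (PolyRing k)}
    (hI : I.IsHomogeneous (homogeneousSubmodule (Fin 3) k)) (hI2 : I.height = 2) :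
    ∃ (a b : ℕ) (f g : PolyRing k), f ∈ I ∧ g ∈ I ∧ f.IsHomogeneous a ∧ g.IsHomogeneous b ∧
      f ≠ 0 ∧ IsRelPrime f g := by
  classical
  obtain ⟨a, f, hfI, hf, hf0⟩ := exists_isHomogeneous_notMem hI (J := ⊥) fun h => by
    rw [le_bot_iff] at h
    rw [h, Ideal.height_bot] at hI2
    exact absurd hI2 (by decide)
  rw [Ideal.mem_bot] at hf0
  set F := (UniqueFactorizationMonoid.factors f).toFinset with hF
  have hprime : ∀ p ∈ F, Prime p := fun p hp =>
    UniqueFactorizationMonoid.prime_of_factor p (Multiset.mem_toFinset.1 hp)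
  -- In all large degrees `I` has elements outside `(p)`: multiply one by powers of a variable that
  -- is not divisible by `p`.
  have key : ∀ p : F, ∃ n : ℕ, ∀ m ≥ n, ∃ g ∈ I, g.IsHomogeneous m ∧ ¬ (p : PolyRing k) ∣ g := by
    rintro ⟨p, hp⟩
    obtain ⟨n, g, hgI, hg, hgp⟩ := exists_isHomogeneous_notMem hI
      (not_le_span_of_height_eq_two hI2 (hprime p hp).not_isUnit)
    rw [Ideal.mem_span_singleton] at hgp
    obtain ⟨i, hi⟩ := exists_not_dvd_X (hprime p hp)
    refine ⟨n, fun m hm => ⟨g * X i ^ (m - n), I.mul_mem_right _ hgI, ?_, fun h => ?_⟩⟩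
    · have := hg.mul (isHomogeneous_X_pow (R := k) i (m - n))
      rwa [Nat.add_sub_cancel' hm] at this
    · rcases (hprime p hp).dvd_or_dvd h with h | h
      · exact hgp h
      · exact hi ((hprime p hp).dvd_of_dvd_pow h)
  choose N hN using key
  obtain ⟨g, hg, hgF⟩ := Submodule.exists_mem_forall_notMem
    (I.restrictScalars k ⊓ homogeneousSubmodule (Fin 3) k (Finset.univ.sup N)) Finset.univ
    (fun p : F => (Ideal.span {(p : PolyRing k)}).restrictScalars k) fun p _ hle => by
      obtain ⟨g, hgI, hg, hgp⟩ := hN p _ (Finset.le_sup (Finset.mem_univ p))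
      exact hgp (Ideal.mem_span_singleton.1 (hle ⟨hgI, hg⟩))
  refine ⟨a, _, f, g, hfI, hg.1, hf, hg.2, hf0, fun q hqf hqg => ?_⟩
  by_contra hq
  obtain ⟨p, hp, hpq⟩ := WfDvdMonoid.exists_irreducible_factor hq (ne_zero_of_dvd_ne_zero hf0 hqf)
  obtain ⟨r, hr, hpr⟩ := UniqueFactorizationMonoid.exists_mem_factors_of_dvd hf0 hp (hpq.trans hqf)
  exact hgF ⟨r, Multiset.mem_toFinset.2 hr⟩ (Finset.mem_univ _)
    (Ideal.mem_span_singleton.2 ((hpr.dvd_iff_dvd_left.1 hpq).trans hqg))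

/-! ### Saturation and nonzerodivisors -/

/-- `z` is a nonzerodivisor modulo `(x, y)`. -/
theorem mem_span_X_pair_of_mul_X {a : PolyRing k}
    (h : a * X 2 ∈ Ideal.span {(X 0 : PolyRing k), X 1}) :
    a ∈ Ideal.span {(X 0 : PolyRing k), X 1} := by
  have hs : ({(X 0 : PolyRing k), X 1} : Set (PolyRing k)) = X '' ({0, 1} : Set (Fin 3)) := by
    rw [Set.image_pair]
  rw [hs, mem_ideal_span_X_image] at h ⊢
  intro m hm
  obtain ⟨i, hi, hne⟩ := h (m + Finsupp.single 2 1) (by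
    rw [mem_support_iff, coeff_mul_X]
    exact mem_support_iff.1 hm)
  refine ⟨i, hi, ?_⟩
  rcases hi with rfl | rfl <;> simpa using hne

/-- Let `W ⊆ Rⁿ` be a submodule with torsion-free quotient. If an ideal `I` is isomorphic to the
quotient of `W` by a free cyclic submodule, then `I` is saturated with respect to `(x, y, z)`. This
is the vanishing of `H⁰(R/I) = H¹(I)` in local cohomology, written out with the Koszul relations
among `x`, `y`, `z`. -/
theorem mem_range_of_forall_X_mul_mem {n : ℕ} {W : Submodule (PolyRing k) (Fin n → PolyRing k)}
    (hW : ∀ (r : PolyRing k) (v : Fin n → PolyRing k), r ≠ 0 → r • v ∈ W → v ∈ W)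
    (u : W →ₗ[PolyRing k] PolyRing k) {ε : W} (hε : ε ≠ 0)
    (hu : LinearMap.ker u = Submodule.span (PolyRing k) {ε}) {h : PolyRing k}
    (hX : ∀ i, X i * h ∈ LinearMap.range u) : h ∈ LinearMap.range u := by
  -- For lifts `wᵢ` of `xᵢ h`, the elements `xᵢ wⱼ - xⱼ wᵢ` lie in the kernel `R ε` of `u`.
  choose w hw using hX
  have hrel : ∀ i j, ∃ a : PolyRing k,
      a • ε = (X i : PolyRing k) • w j - (X j : PolyRing k) • w i := by
    intro i j
    rw [← Submodule.mem_span_singleton, ← hu, LinearMap.mem_ker, map_sub, map_smul, map_smul, hw,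
      hw, smul_eq_mul, smul_eq_mul]
    ring
  obtain ⟨a, ha⟩ := hrel 1 0
  obtain ⟨b, hb⟩ := hrel 2 1
  obtain ⟨c, hc⟩ := hrel 0 2
  have habc : a * X 2 + b * X 0 + c * X 1 = 0 := by
    have : (a * X 2 + b * X 0 + c * X 1) • ε = 0 := by
      rw [add_smul, add_smul, mul_comm a, mul_comm b, mul_comm c, mul_smul, mul_smul, mul_smul,
        ha, hb, hc]
      module
    exact (smul_eq_zero.1 this).resolve_right hε
  obtain ⟨β, α, hαβ⟩ := Ideal.mem_span_pair.1 (mem_span_X_pair_of_mul_X (a := a)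
    (Ideal.mem_span_pair.2 ⟨-b, -c, by linear_combination -habc⟩))
  -- The corrected lifts `w₀ - αε` and `w₁ + βε` satisfy `y (w₀ - αε) = x (w₁ + βε)`.
  have heq : (X 1 : PolyRing k) • (w 0 - α • ε) = (X 0 : PolyRing k) • (w 1 + β • ε) := by
    rw [← sub_eq_zero]
    have : (X 1 : PolyRing k) • (w 0 - α • ε) - (X 0 : PolyRing k) • (w 1 + β • ε) =
        ((X 1 : PolyRing k) • w 0 - (X 0 : PolyRing k) • w 1) - (β * X 0 + α * X 1) • ε := by
      module
    rw [this, ← ha, hαβ, sub_self]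
  have hdvd : ∀ i, (X 0 : PolyRing k) ∣ ((w 0 - α • ε : W) : Fin n → PolyRing k) i := by
    intro i
    have h1 : (X 0 : PolyRing k) ∣ X 1 * ((w 0 - α • ε : W) : Fin n → PolyRing k) i :=
      ⟨((w 1 + β • ε : W) : Fin n → PolyRing k) i,
        congrFun (congrArg (fun v : W => (v : Fin n → PolyRing k)) heq) i⟩
    refine ((X_prime (R := k)).dvd_or_dvd h1).resolve_left ?_
    simp [X_dvd_X]
  choose v hv using hdvd
  have hv' : (X 0 : PolyRing k) • v = ((w 0 - α • ε : W) : Fin n → PolyRing k) :=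
    funext fun i => (hv i).symm
  have hvW : v ∈ W := hW (X 0) v (X_ne_zero 0) (hv' ▸ (w 0 - α • ε).2)
  refine ⟨⟨v, hvW⟩, mul_left_cancel₀ (X_ne_zero (R := k) (0 : Fin 3)) ?_⟩
  have h0 : u ε = 0 := by
    rw [← LinearMap.mem_ker, hu]
    exact Submodule.mem_span_singleton_self ε
  rw [← hw 0, ← smul_eq_mul, ← map_smul]
  have : (X 0 : PolyRing k) • (⟨v, hvW⟩ : W) = w 0 - α • ε := Subtype.ext hv'
  rw [this, map_sub, map_smul, h0, smul_zero, sub_zero]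

/-- Over an infinite field, some linear form is a nonzerodivisor modulo a saturated ideal. -/
theorem exists_linear_nonZeroDivisor [Infinite k] {I : Ideal (PolyRing k)}
    (hI : ∀ h : PolyRing k, (∀ i, X i * h ∈ I) → h ∈ I) :
    ∃ l : PolyRing k, l.IsHomogeneous 1 ∧ ∀ h, l * h ∈ I → h ∈ I := by
  have hfin := associatedPrimes.finite (PolyRing k) (PolyRing k ⧸ I)
  obtain ⟨l, hl, hlP⟩ := Submodule.exists_mem_forall_notMem (homogeneousSubmodule (Fin 3) k 1)
    hfin.toFinset (fun P => P.restrictScalars k) fun P hP hle => by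
      rw [Set.Finite.mem_toFinset] at hP
      obtain ⟨hPp, x, hx⟩ := isAssociatedPrime_iff.1 hP
      obtain ⟨h, rfl⟩ := Ideal.Quotient.mk_surjective x
      have hh : h ∈ I := hI h fun i => by
        have : (X i : PolyRing k) ∈ P := hle (isHomogeneous_X k i)
        rw [hx, Submodule.mem_colon_singleton, Submodule.mem_bot, ← Ideal.Quotient.mk_eq_mk,
          ← Submodule.Quotient.mk_smul, Submodule.Quotient.mk_eq_zero] at this
        exact this
      refine hPp.ne_top (Ideal.eq_top_iff_one P |>.2 ?_)
      rw [hx, Submodule.mem_colon_singleton, Ideal.Quotient.eq_zero_iff_mem.2 hh]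
      simp
  refine ⟨l, hl, fun h hlh => ?_⟩
  have hreg : IsSMulRegular (PolyRing k ⧸ I) l := by
    by_contra hreg
    have := biUnion_associatedPrimes_eq_compl_regular (PolyRing k) (PolyRing k ⧸ I)
    have hmem : l ∈ ⋃ p ∈ associatedPrimes (PolyRing k) (PolyRing k ⧸ I),
        (p : Set (PolyRing k)) := by
      rw [this]
      exact hreg
    simp only [Set.mem_iUnion, exists_prop] at hmem
    obtain ⟨P, hP, hlP'⟩ := hmem
    exact hlP P (hfin.mem_toFinset.2 hP) hlP'
  rw [← Ideal.Quotient.eq_zero_iff_mem]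
  rw [isSMulRegular_iff_right_eq_zero_of_smul] at hreg
  refine hreg _ ?_
  rw [← Ideal.Quotient.mk_eq_mk, ← Submodule.Quotient.mk_smul, Submodule.Quotient.mk_eq_zero]
  exact hlh

/-- Multiplication by a linear nonzerodivisor embeds `(R/I)ₙ` into `(R/I)ₙ₊₁`. -/
theorem hilbertFunction_monotone {I : Ideal (PolyRing k)} {l : PolyRing k}
    (hl : l.IsHomogeneous 1) (hlI : ∀ h, l * h ∈ I → h ∈ I) : Monotone (hilbertFunction I) := by
  refine monotone_nat_of_le_succ fun n => ?_
  let q := (Ideal.Quotient.mkₐ k I).toLinearMap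
  let m : (PolyRing k ⧸ I) →ₗ[k] (PolyRing k ⧸ I) := LinearMap.mulLeft k (Ideal.Quotient.mk I l)
  have hm : Function.Injective m := by
    rw [injective_iff_map_eq_zero]
    intro x hx
    obtain ⟨h, rfl⟩ := Ideal.Quotient.mk_surjective x
    have hx' : Ideal.Quotient.mk I (l * h) = 0 := by rw [map_mul]; exact hx
    rw [Ideal.Quotient.eq_zero_iff_mem] at hx' ⊢
    exact hlI h hx'
  have hle : ((homogeneousSubmodule (Fin 3) k n).map q).map m ≤
      (homogeneousSubmodule (Fin 3) k (n + 1)).map q := by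
    rintro _ ⟨_, ⟨p, hp, rfl⟩, rfl⟩
    refine ⟨l * p, ?_, map_mul (Ideal.Quotient.mk I) l p⟩
    rw [SetLike.mem_coe, mem_homogeneousSubmodule, add_comm]
    exact hl.mul hp
  calc hilbertFunction I n
      = Module.finrank k (((homogeneousSubmodule (Fin 3) k n).map q).map m) :=
        (LinearEquiv.finrank_eq (Submodule.equivMapOfInjective m hm _))
    _ ≤ _ := Submodule.finrank_mono hle

/-! ### Saturated ideals of height two and degree two -/

theorem irreducible_of_isHomogeneous_one {l : PolyRing k} (hl : l.IsHomogeneous 1) (hl0 : l ≠ 0) :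
    Irreducible l := by
  refine irreducible_of_totalDegree_eq_one (hl.totalDegree hl0) fun x hx => ?_
  obtain ⟨m, hm⟩ := ne_zero_iff.1 hl0
  exact isUnit_iff_ne_zero.2 fun h0 => hm (by simpa [h0] using hx m)

/-- A linear form does not divide all elements of degree `n` of an ideal with
`H(n) < n + 1 = H_{R/(l)}(n)`. -/
theorem exists_not_dvd_of_hilbertFunction_lt {I : Ideal (PolyRing k)} {l : PolyRing k}
    (hl : l.IsHomogeneous 1) {n : ℕ} (hn : hilbertFunction I n < n + 1) :
    ∃ q ∈ I, q.IsHomogeneous n ∧ ¬ l ∣ q := by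
  by_contra! h
  rw [← mem_piece_natCast] at hl
  have hle : (I.restrictScalars k ⊓ homogeneousSubmodule (Fin 3) k n : Submodule k (PolyRing k)) ≤
      (piece k ((n : ℤ) - 1)).map (LinearMap.mulRight k l) := by
    rintro q ⟨hqI, hq⟩
    obtain ⟨r, hr⟩ := h q hqI hq
    have hq' : q ∈ piece k (n : ℤ) := mem_piece_natCast.2 hq
    refine ⟨intComponent ((n : ℤ) - 1) r, intComponent_mem _ _, ?_⟩
    rw [LinearMap.mulRight_apply]
    have := intComponent_mul hl r ((n : ℤ) - 1)
    rw [mul_comm r l, ← hr, Nat.cast_one, sub_add_cancel, intComponent_of_mem hq'] at this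
    exact this.symm
  have h1 := (Submodule.finrank_mono hle).trans (Submodule.finrank_map_le _ _)
  have h2 := hilbertFunction_add_finrank I n
  have h3 : piece k (n : ℤ) = homogeneousSubmodule (Fin 3) k n := by simp [piece]
  rw [← h3] at h1 h2
  have e0 := two_mul_finrank_piece (k := k) (j := n) (by omega)
  have e1 := two_mul_finrank_piece (k := k) (j := (n : ℤ) - 1) (by omega)
  zify at h1 h2 hn
  nlinarith

/-- A saturated homogeneous ideal of height two and degree two is generated by a quadratic and
a linear form: its Hilbert function is `1, 2, 2, 2, …`. -/
theorem exists_eq_span_of_degQuot_eq_two [Infinite k] {I : Ideal (PolyRing k)}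
    (hI : I.IsHomogeneous (homogeneousSubmodule (Fin 3) k)) (hI2 : I.height = 2)
    (hsat : ∀ h : PolyRing k, (∀ i, X i * h ∈ I) → h ∈ I) (hdeg : degQuot I = 2) :
    ∃ q l : PolyRing k, q.IsHomogeneous 2 ∧ l.IsHomogeneous 1 ∧ l ≠ 0 ∧ IsRelPrime l q ∧
      I = Ideal.span {q, l} := by
  have hIt : I ≠ ⊤ := by
    rintro rfl
    rw [Ideal.height_top] at hI2
    exact absurd hI2 (by decide)
  have hunit : ∀ c : k, C c ∈ I → c = 0 := by
    intro c hc
    by_contra h0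
    exact hIt (Ideal.eq_top_of_isUnit_mem I hc ((isUnit_iff_ne_zero.2 h0).map C))
  obtain ⟨m, hm, hmI⟩ := exists_linear_nonZeroDivisor hsat
  have hmono := hilbertFunction_monotone hm hmI
  obtain ⟨a, b, f, g, hfI, hgI, hf, hg, hf0, hfg⟩ := exists_isRelPrime_of_height_eq_two hI hI2
  -- The Hilbert function is nondecreasing and bounded, hence constant in large degrees, and the
  -- constant is the degree `2`.
  have hbound : ∀ n, hilbertFunction I n ≤ a * b := by
    intro n
    refine (hmono (Nat.le_add_right n (a + b))).trans ?_
    rw [← hilbertFunction_span_pair (n := n + (a + b)) hf hg hf0 hfg (by omega)]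
    refine hilbertFunction_anti (Ideal.span_le.2 ?_) _
    rintro x (rfl | rfl) <;> assumption
  obtain ⟨n₀, hn₀⟩ : ∃ n₀, ∀ n, hilbertFunction I n ≤ hilbertFunction I n₀ := by
    obtain ⟨n₀, hn₀⟩ := Nat.sSup_mem (Set.range_nonempty (hilbertFunction I))
      ⟨a * b, Set.forall_mem_range.2 hbound⟩
    exact ⟨n₀, fun n => hn₀ ▸ le_csSup ⟨a * b, Set.forall_mem_range.2 hbound⟩ ⟨n, rfl⟩⟩
  have hc0 : hilbertFunction I n₀ ≠ 0 := by
    intro h0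
    have h1 : hilbertFunction I 0 = 0 := Nat.le_zero.1 (h0 ▸ hn₀ 0)
    have h2 : hilbertFunction (⊤ : Ideal (PolyRing k)) 0 = 0 :=
      Nat.le_zero.1 ((hilbertFunction_anti (le_top (a := I)) 0).trans h1.le)
    refine hIt ((Ideal.eq_top_iff_one I).2 ?_)
    exact mem_of_hilbertFunction_eq le_top (h1.trans h2.symm) Submodule.mem_top
      (isHomogeneous_one _ _)
  have hc := degQuot_of_hilbertFunction hc0 (Filter.eventually_atTop.2
    ⟨n₀, fun n hn => le_antisymm (hn₀ n) (hmono hn)⟩)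
  have hn₀2 : hilbertFunction I n₀ = 2 := by exact_mod_cast hc.symm.trans hdeg
  rw [hn₀2] at hn₀
  -- The degree one part of `I` is nonzero since `H(1) ≤ 2 < 3 = dim R₁`.
  obtain ⟨l, hlI, hl, hl0⟩ : ∃ l ∈ I, l.IsHomogeneous 1 ∧ l ≠ 0 := by
    have h1 := hilbertFunction_add_finrank I 1
    rw [finrank_homogeneousSubmodule, show (1 + 2 : ℕ).choose 2 = 3 from rfl] at h1
    have h2 := hn₀ 1
    have h3 : (I.restrictScalars k ⊓ homogeneousSubmodule (Fin 3) k 1 :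
        Submodule k (PolyRing k)) ≠ ⊥ := by
      intro hb
      rw [hb, finrank_bot] at h1
      omega
    obtain ⟨l, hl, hl0⟩ := Submodule.exists_mem_ne_zero_of_ne_bot h3
    exact ⟨l, hl.1, hl.2, hl0⟩
  have hirr := irreducible_of_isHomogeneous_one hl hl0
  -- Two independent linear forms in `I` would give `H ≤ 1`.
  have hH1 : 2 ≤ hilbertFunction I 1 := by
    by_contra! hlt
    obtain ⟨l', hlI', hl', hll'⟩ := exists_not_dvd_of_hilbertFunction_lt hl (I := I) (n := 1) hlt
    have h1 := hilbertFunction_span_pair (n := n₀) hl hl' hl0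
      (hirr.isRelPrime_iff_not_dvd.2 hll') (by omega)
    have h2 : hilbertFunction I n₀ ≤ hilbertFunction (Ideal.span {l, l'}) n₀ := by
      refine hilbertFunction_anti (Ideal.span_le.2 ?_) _
      rintro x (rfl | rfl) <;> assumption
    omega
  have hH : ∀ n, 1 ≤ n → hilbertFunction I n = 2 := fun n hn =>
    le_antisymm (hn₀ n) (hH1.trans (hmono hn))
  obtain ⟨q, hqI, hq, hlq⟩ := exists_not_dvd_of_hilbertFunction_lt hl (I := I) (n := 2)
    (by rw [hH 2 (by omega)]; omega)
  have hrel : IsRelPrime l q := hirr.isRelPrime_iff_not_dvd.2 hlq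
  refine ⟨q, l, hq, hl, hl0, hrel, ?_⟩
  have hle : Ideal.span {l, q} ≤ I := by
    refine Ideal.span_le.2 ?_
    rintro x (rfl | rfl) <;> assumption
  rw [Set.pair_comm]
  refine le_antisymm (fun p hp => ?_) hle
  rw [← sum_homogeneousComponent p]
  refine sum_mem fun n _ => ?_
  have hpn := homogeneousComponent_mem_of_mem hI hp n
  rcases Nat.eq_zero_or_pos n with rfl | hn
  · rw [homogeneousComponent_zero] at hpn ⊢
    rw [hunit _ hpn, C_0]
    exact zero_mem _
  · refine mem_of_hilbertFunction_eq hle ?_ hpn (homogeneousComponent_isHomogeneous n p)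
    rw [hH n hn, hilbertFunction_span_pair hl hq hl0 hrel (by omega)]

/-! ### Syzygies -/

theorem mem_syz {f : PolyRing k} {v : Fin 3 → PolyRing k} :
    v ∈ syz f ↔ ∑ i, v i * pderiv i f = 0 := by
  rw [syz, LinearMap.mem_ker, Fintype.linearCombination_apply]
  rfl

theorem mem_syz_of_smul_mem {f : PolyRing k} (r : PolyRing k) (v : Fin 3 → PolyRing k) (hr : r ≠ 0)
    (h : r • v ∈ syz f) : v ∈ syz f :=
  (smul_eq_zero.1 ((map_smul _ r v).symm.trans h)).resolve_left hr

theorem mem_irrelevantIdeal_smul_top {n : ℕ} {v : Fin n → PolyRing k} :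
    v ∈ irrelevantIdeal k • (⊤ : Submodule (PolyRing k) (Fin n → PolyRing k)) ↔
      ∀ i, v i ∈ irrelevantIdeal k := by
  classical
  constructor
  · intro h i
    refine Submodule.smul_induction_on h (fun r hr w _ => ?_) fun x y hx hy => ?_
    · exact Ideal.mul_mem_right _ _ hr
    · exact add_mem hx hy
  · intro h
    rw [pi_eq_sum_univ' v]
    exact sum_mem fun i _ => Submodule.smul_mem_smul (h i) Submodule.mem_top

/-- Homogeneous elements in the image of a graded map on `Syz(J_f)` have homogeneous preimages. -/
theorem exists_lift {f : PolyRing k} {d : ℕ} (hf : f.IsHomogeneous (d + 1))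
    {u : syz f →ₗ[PolyRing k] PolyRing k} {c : ℤ}
    (hu : ∀ (j : ℤ) (w : syz f), (w : Fin 3 → PolyRing k) ∈ freePiece (k := k) (0 : Fin 3 → ℤ) j →
      u w ∈ piece k (j + c)) {j : ℤ} {p : PolyRing k} (hp : p ∈ piece k (j + c))
    (hpu : p ∈ LinearMap.range u) :
    ∃ w : syz f, (w : Fin 3 → PolyRing k) ∈ freePiece (k := k) (0 : Fin 3 → ℤ) j ∧ u w = p := by
  obtain ⟨w, rfl⟩ := hpu
  refine ⟨⟨vecComponent 0 j w, vecComponent_mem_syz hf j w.2⟩,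
    vecComponent_mem _ j (w : Fin 3 → PolyRing k), ?_⟩
  rw [map_vecComponent (fun j v hv => vecComponent_mem_syz hf j hv) u hu w j,
    intComponent_of_mem hp]

/-- If `Syz / (ε)` is isomorphic to an ideal containing coprime elements, and `ε` has a constant
nonzero coordinate, then the ideal is the whole ring. -/
theorem range_eq_top_of_coord_eq_C {n : ℕ} {W : Submodule (PolyRing k) (Fin n → PolyRing k)}
    (hW : ∀ (r : PolyRing k) (v : Fin n → PolyRing k), r ≠ 0 → r • v ∈ W → v ∈ W)
    (u : W →ₗ[PolyRing k] PolyRing k) {ε : W}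
    (hu : LinearMap.ker u = Submodule.span (PolyRing k) {ε}) {i : Fin n} {c : k} (hc : c ≠ 0)
    (hi : (ε : Fin n → PolyRing k) i = C c) {p q : PolyRing k} (hp : p ∈ LinearMap.range u)
    (hq : q ∈ LinearMap.range u) (hp0 : p ≠ 0) (hpq : IsRelPrime p q) :
    LinearMap.range u = ⊤ := by
  have hε : u ε = 0 := by
    rw [← LinearMap.mem_ker, hu]
    exact Submodule.mem_span_singleton_self ε
  -- Subtracting a multiple of `ε` makes the `i`-th coordinate of a preimage vanish. For two such
  -- preimages `w`, `w'` of `p`, `q` the element `q w - p w' ∈ R ε` is then zero.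
  have lift : ∀ p ∈ LinearMap.range u, ∃ w : W, (w : Fin n → PolyRing k) i = 0 ∧ u w = p := by
    rintro _ ⟨w, rfl⟩
    refine ⟨w - ((w : Fin n → PolyRing k) i * C c⁻¹) • ε, ?_, ?_⟩
    · have : (C c⁻¹ : PolyRing k) * C c = 1 := by rw [← C_mul, inv_mul_cancel₀ hc, C_1]
      simp [hi, mul_assoc, this]
    · rw [map_sub, map_smul, hε, smul_zero, sub_zero]
  obtain ⟨w, hw, rfl⟩ := lift p hp
  obtain ⟨w', hw', rfl⟩ := lift q hq
  obtain ⟨s, hs⟩ : ∃ s : PolyRing k, s • ε = u w' • w - u w • w' := by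
    rw [← Submodule.mem_span_singleton, ← hu, LinearMap.mem_ker, map_sub, map_smul, map_smul,
      smul_eq_mul, smul_eq_mul]
    ring
  have hs' : ∀ j, s * (ε : Fin n → PolyRing k) j =
      u w' * (w : Fin n → PolyRing k) j - u w * (w' : Fin n → PolyRing k) j :=
    fun j => congrFun (congrArg (fun v : W => (v : Fin n → PolyRing k)) hs) j
  have hs0 : s = 0 := by
    have := hs' i
    rw [hw, hw', hi, mul_zero, mul_zero, sub_zero] at this
    exact (mul_eq_zero.1 this).resolve_right (by simpa using hc)
  have hdvd : ∀ j, u w ∣ (w : Fin n → PolyRing k) j := fun j =>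
    hpq.dvd_of_dvd_mul_left ⟨(w' : Fin n → PolyRing k) j, by
      have := hs' j
      rw [hs0] at this
      linear_combination -this⟩
  choose v hv using hdvd
  have hwv : u w • v = (w : Fin n → PolyRing k) := funext fun j => (hv j).symm
  have hvW : v ∈ W := hW _ v hp0 (hwv ▸ w.2)
  refine (Ideal.eq_top_iff_one (LinearMap.range u)).2 ⟨⟨v, hvW⟩, mul_left_cancel₀ hp0 ?_⟩
  rw [← smul_eq_mul, ← map_smul, mul_one]
  exact congrArg u (Subtype.ext hwv)

/-! ### The resolution defined by a Bourbaki ideal of degree two -/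

theorem indegSyz_le {f : PolyRing k} {j : ℤ} {v : Fin 3 → PolyRing k} (hv : v ∈ syz f)
    (hv0 : v ≠ 0) (hvj : v ∈ freePiece (k := k) (0 : Fin 3 → ℤ) j) : (indegSyz f : ℤ) ≤ j := by
  obtain ⟨i, hi⟩ := Function.ne_iff.1 hv0
  have hj := nonneg_of_mem_piece (mem_freePiece.1 hvj i) hi
  simp only [Pi.zero_apply, sub_zero] at hj
  lift j to ℕ using hj
  exact Int.ofNat_le.2 (Nat.sInf_le (by exact ⟨v, hv, hv0, hvj⟩))

/-- A Bourbaki ideal of degree two is generated by a coprime pair of a quadratic and a linear form: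
it has height two and is saturated. -/
theorem IsBourbakiIdeal.exists_eq_span [Infinite k] {f : PolyRing k} {d e : ℕ}
    {ε : syz f} {I : Ideal (PolyRing k)} (hB : IsBourbakiIdeal d e f ε I) (hε : ε ≠ 0)
    (hdeg : degQuot I = 2) :
    I.height = 2 ∧ ∃ q l : PolyRing k, q.IsHomogeneous 2 ∧ l.IsHomogeneous 1 ∧ l ≠ 0 ∧
      IsRelPrime l q ∧ I = Ideal.span {q, l} := by
  have hfree : ¬ IsFreeDivisor f := by
    intro h
    rw [hB.eq_top h, degQuot_top] at hdeg
    exact absurd hdeg (by norm_num)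
  have hI2 := hB.height_eq_two hfree
  obtain ⟨u, hker, hrange, -⟩ := hB.exists_sequence
  refine ⟨hI2, exists_eq_span_of_degQuot_eq_two hB.homogeneous hI2 (fun h hX => ?_) hdeg⟩
  rw [← hrange] at hX ⊢
  exact mem_range_of_forall_X_mul_mem mem_syz_of_smul_mem u hε hker hX

/-- A Bourbaki ideal of degree two determines the minimal free resolution of `R/J_f`: lifts
`g₁`, `g₂` of its generators `q`, `l` generate `Syz(J_f)` together with `ε`, and the only relation
lifts the Koszul relation `l q - q l = 0`. -/
theorem IsBourbakiIdeal.resolution [Infinite k] {f : PolyRing k} {d e : ℕ}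
    (hf : f.IsHomogeneous (d + 1)) (he : e = indegSyz f) {ε : syz f}
    {I : Ideal (PolyRing k)} (hB : IsBourbakiIdeal d e f ε I) (hε : ε ≠ 0)
    (hεe : (ε : Fin 3 → PolyRing k) ∈ freePiece (k := k) (0 : Fin 3 → ℤ) e)
    (hdeg : degQuot I = 2) :
    (e : ℤ) ≤ d - e + 1 ∧
    HasMinimalGradedFreeResolution (gradientIdeal f) ![0] ![(d : ℤ), (d : ℤ), (d : ℤ)]
        ![(d : ℤ) + (d - e + 2), (d : ℤ) + (d - e + 1), (d : ℤ) + e]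
        ![(d : ℤ) + (d - e + 3)] := by
  obtain ⟨hI2, q, l, hq, hl, hl0, hlq, hspan⟩ := hB.exists_eq_span hε hdeg
  obtain ⟨u, hker, hrange, hu⟩ := hB.exists_sequence
  have hqI : q ∈ LinearMap.range u := hrange ▸ hspan ▸ Ideal.subset_span (by simp)
  have hlI : l ∈ LinearMap.range u := hrange ▸ hspan ▸ Ideal.subset_span (by simp)
  have huε : u ε = 0 := by
    rw [← LinearMap.mem_ker, hker]
    exact Submodule.mem_span_singleton_self ε
  have hε' : (ε : Fin 3 → PolyRing k) ≠ 0 := fun h => hε (Subtype.ext h)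
  obtain ⟨i₀, hi₀⟩ := Function.ne_iff.1 hε'
  have hεp : ∀ i, (ε : Fin 3 → PolyRing k) i ∈ piece k (e : ℤ) := fun i => by
    simpa using mem_freePiece.1 hεe i
  -- A constant syzygy `ε` would make the Bourbaki ideal the whole ring.
  have he0 : 0 < (e : ℤ) := by
    by_contra hle
    have h0 : (e : ℤ) = 0 := by omega
    obtain ⟨c, hc⟩ := exists_C_of_mem_piece_zero (h0 ▸ hεp i₀)
    have hc0 : c ≠ 0 := by
      rintro rfl
      exact hi₀ (by rw [hc, C_0]; rfl)
    have := range_eq_top_of_coord_eq_C mem_syz_of_smul_mem u hker hc0 hc hlI hqI hl0 hlq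
    rw [← hrange, this, Ideal.height_top] at hI2
    exact absurd hI2 (by decide)
  obtain ⟨g₁, hg₁, hug₁⟩ := exists_lift hf hu (j := d - e + 2) (p := q) (by
    rw [show (d : ℤ) - e + 2 + (e - d) = (2 : ℕ) by push_cast; ring]
    exact mem_piece_natCast.2 hq) hqI
  obtain ⟨g₂, hg₂, hug₂⟩ := exists_lift hf hu (j := d - e + 1) (p := l) (by
    rw [show (d : ℤ) - e + 1 + (e - d) = (1 : ℕ) by push_cast; ring]
    exact mem_piece_natCast.2 hl) hlI
  have hg₁p : ∀ i, (g₁ : Fin 3 → PolyRing k) i ∈ piece k ((d : ℤ) - e + 2) := fun i => by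
    simpa using mem_freePiece.1 hg₁ i
  have hg₂p : ∀ i, (g₂ : Fin 3 → PolyRing k) i ∈ piece k ((d : ℤ) - e + 1) := fun i => by
    simpa using mem_freePiece.1 hg₂ i
  have hed : (e : ℤ) ≤ d - e + 1 := by
    rw [he] at hg₂ ⊢
    refine indegSyz_le g₂.2 (fun h => hl0 ?_) hg₂
    rw [← hug₂, show g₂ = 0 from Subtype.ext h, map_zero]
  refine ⟨hed, ?_⟩
  have hqp : q ∈ piece k (2 : ℤ) := mem_piece_natCast.2 hq
  have hlp : l ∈ piece k (1 : ℤ) := mem_piece_natCast.2 hl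
  -- The relation between the generators, with the coefficient of `ε` made homogeneous.
  obtain ⟨m, hm, hrel⟩ : ∃ m ∈ piece k ((d : ℤ) - 2 * e + 3), m • ε = l • g₁ - q • g₂ := by
    obtain ⟨m, hm⟩ : ∃ m : PolyRing k, m • ε = l • g₁ - q • g₂ := by
      rw [← Submodule.mem_span_singleton, ← hker, LinearMap.mem_ker, map_sub, map_smul, map_smul,
        hug₁, hug₂, smul_eq_mul, smul_eq_mul]
      ring
    refine ⟨_, intComponent_mem _ m, Subtype.ext (funext fun i => ?_)⟩
    have hmi := congrFun (congrArg (fun v : syz f => (v : Fin 3 → PolyRing k)) hm) i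
    have h1 : l * (g₁ : Fin 3 → PolyRing k) i - q * (g₂ : Fin 3 → PolyRing k) i ∈
        piece k ((d : ℤ) - 2 * e + 3 + e) := by
      refine sub_mem ?_ ?_
      · have := mul_mem_piece hlp (hg₁p i)
        rwa [show (1 : ℤ) + (d - e + 2) = d - 2 * e + 3 + e by ring] at this
      · have := mul_mem_piece hqp (hg₂p i)
        rwa [show (2 : ℤ) + (d - e + 1) = d - 2 * e + 3 + e by ring] at this
    have h2 := intComponent_mul (hεp i) m ((d : ℤ) - 2 * e + 3)
    rw [show m * (ε : Fin 3 → PolyRing k) i = _ from hmi] at h2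
    exact h2.symm.trans (intComponent_of_mem h1)
  have hpd : ∀ i, pderiv i f ∈ piece k (d : ℤ) := fun i => mem_piece_natCast.2 hf.pderiv
  let π : (Fin 1 → PolyRing k) →ₗ[PolyRing k] PolyRing k ⧸ gradientIdeal f :=
    Submodule.mkQ (gradientIdeal f) ∘ₗ LinearMap.proj 0
  let φ₁ : (Fin 3 → PolyRing k) →ₗ[PolyRing k] (Fin 1 → PolyRing k) :=
    LinearMap.pi fun _ => Fintype.linearCombination (PolyRing k) fun i => pderiv i f
  let φ₂ : (Fin 3 → PolyRing k) →ₗ[PolyRing k] (Fin 3 → PolyRing k) :=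
    Fintype.linearCombination (PolyRing k)
      ![(g₁ : Fin 3 → PolyRing k), (g₂ : Fin 3 → PolyRing k), (ε : Fin 3 → PolyRing k)]
  let φ₃ : (Fin 1 → PolyRing k) →ₗ[PolyRing k] (Fin 3 → PolyRing k) :=
    (LinearMap.proj 0).smulRight ![l, -q, -m]
  have hφ₁ : ∀ v i, φ₁ v i = ∑ j, v j * pderiv j f := fun v i => rfl
  have hφ₂ : ∀ v, φ₂ v = ((v 0 • g₁ + v 1 • g₂ + v 2 • ε : syz f) : Fin 3 → PolyRing k) := by
    intro v
    simp [φ₂, Fintype.linearCombination_apply, Fin.sum_univ_three]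
  have hφ₂' : ∀ v i, φ₂ v i = v 0 * (g₁ : Fin 3 → PolyRing k) i +
      v 1 * (g₂ : Fin 3 → PolyRing k) i + v 2 * (ε : Fin 3 → PolyRing k) i :=
    fun v i => by rw [hφ₂]; rfl
  have hφ₃ : ∀ v, φ₃ v = ![v 0 * l, v 0 * -q, v 0 * -m] := by
    intro v
    ext i : 1
    fin_cases i <;> rfl
  refine ⟨π, φ₁, φ₂, φ₃, ?_, ?_, ?_, ?_, ?_, ?_, ?_, ?_, ?_, ?_, ?_, ?_⟩
  · intro j v hv
    refine ⟨v 0, ?_, rfl⟩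
    simpa using mem_freePiece.1 hv 0
  · intro j v hv
    refine mem_freePiece.2 fun i => ?_
    rw [hφ₁]
    refine sum_mem fun a _ => ?_
    have := mul_mem_piece (mem_freePiece.1 hv a) (hpd a)
    have h1 : (![(d : ℤ), (d : ℤ), (d : ℤ)] : Fin 3 → ℤ) a = d := by fin_cases a <;> rfl
    have h2 : (![0] : Fin 1 → ℤ) i = 0 := by fin_cases i; rfl
    rwa [h1, sub_add_cancel, ← sub_zero j, ← h2] at this
  · intro j v hv
    refine mem_freePiece.2 fun i => ?_
    rw [hφ₂']
    have h1 : (![(d : ℤ), (d : ℤ), (d : ℤ)] : Fin 3 → ℤ) i = d := by fin_cases i <;> rfl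
    rw [h1]
    have hv := mem_freePiece.1 hv
    refine add_mem (add_mem ?_ ?_) ?_
    · have := mul_mem_piece (hv 0) (hg₁p i)
      exact mem_piece_of_eq (by simp; ring) this
    · have := mul_mem_piece (hv 1) (hg₂p i)
      exact mem_piece_of_eq (by simp; ring) this
    · have := mul_mem_piece (hv 2) (hεp i)
      exact mem_piece_of_eq (by simp; ring) this
  · intro j v hv
    have hv := mem_freePiece.1 hv 0
    refine mem_freePiece.2 fun i => ?_
    rw [hφ₃]
    fin_cases i
    · have := mul_mem_piece hv hlp
      exact mem_piece_of_eq (by simp; ring) this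
    · have := mul_mem_piece hv (neg_mem hqp)
      exact mem_piece_of_eq (by simp; ring) this
    · have := mul_mem_piece hv (neg_mem hm)
      exact mem_piece_of_eq (by simp; ring) this
  · intro x
    obtain ⟨p, rfl⟩ := Submodule.mkQ_surjective _ x
    exact ⟨fun _ => p, rfl⟩
  · intro v
    have hJ : v 0 ∈ gradientIdeal f ↔ ∃ c : Fin 3 → PolyRing k, ∑ i, c i * pderiv i f = v 0 := by
      rw [gradientIdeal, Ideal.mem_span_range_iff_exists_fun]
    have h0 : π v = 0 ↔ v 0 ∈ gradientIdeal f := Submodule.Quotient.mk_eq_zero _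
    rw [h0, hJ, Set.mem_range]
    constructor
    · rintro ⟨c, hc⟩
      refine ⟨c, funext fun i => ?_⟩
      fin_cases i
      exact hc
    · rintro ⟨c, rfl⟩
      exact ⟨c, rfl⟩
  · intro v
    have hv : φ₁ v = 0 ↔ v ∈ syz f := by
      rw [mem_syz]
      exact ⟨fun h => congrFun h 0, fun h => funext fun _ => h⟩
    rw [hv, Set.mem_range]
    constructor
    · intro hvs
      have huv : u ⟨v, hvs⟩ ∈ Ideal.span {q, l} := by
        rw [← hspan, ← hrange]
        exact LinearMap.mem_range_self u _
      obtain ⟨a, b, hab⟩ := Ideal.mem_span_pair.1 huv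
      obtain ⟨c, hc⟩ : ∃ c : PolyRing k, c • ε = ⟨v, hvs⟩ - (a • g₁ + b • g₂) := by
        rw [← Submodule.mem_span_singleton, ← hker, LinearMap.mem_ker, map_sub, map_add, map_smul,
          map_smul, hug₁, hug₂, smul_eq_mul, smul_eq_mul, hab, sub_self]
      refine ⟨![a, b, c], ?_⟩
      rw [hφ₂]
      have : a • g₁ + b • g₂ + c • ε = ⟨v, hvs⟩ := by rw [hc]; abel
      exact congrArg (fun v : syz f => (v : Fin 3 → PolyRing k)) this
    · rintro ⟨w, rfl⟩
      rw [hφ₂]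
      exact Subtype.mem _
  · intro v
    rw [Set.mem_range]
    constructor
    · intro hv
      have hv' : v 0 • g₁ + v 1 • g₂ + v 2 • ε = 0 := Subtype.ext ((hφ₂ v).symm.trans hv)
      have huv := congrArg u hv'
      rw [map_add, map_add, map_smul, map_smul, map_smul, hug₁, hug₂, huε, map_zero, smul_zero,
        add_zero, smul_eq_mul, smul_eq_mul] at huv
      obtain ⟨t, ht⟩ := hlq.dvd_of_dvd_mul_right (⟨-v 1, by linear_combination huv⟩ : l ∣ v 0 * q)
      have ht1 : v 1 = t * -q := by
        refine mul_right_cancel₀ hl0 ?_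
        rw [ht] at huv
        linear_combination huv
      have ht2 : v 2 = t * -m := by
        have : (v 2 + t * m) • ε = 0 := by
          rw [add_smul, mul_smul, hrel, ← hv', ht, ht1]
          module
        have := (smul_eq_zero.1 this).resolve_right hε
        linear_combination this
      refine ⟨fun _ => t, ?_⟩
      rw [hφ₃]
      ext i : 1
      fin_cases i
      · simp [ht, mul_comm]
      · simp [ht1]
      · simp [ht2]
    · rintro ⟨w, rfl⟩
      rw [hφ₃, hφ₂]
      have : (w 0 * l) • g₁ + (w 0 * -q) • g₂ + (w 0 * -m) • ε = 0 := by
        have h : (w 0 * l) • g₁ + (w 0 * -q) • g₂ + (w 0 * -m) • ε =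
          w 0 • (l • g₁ - q • g₂) - w 0 • m • ε := by module
        rw [h, hrel, sub_self]
      exact congrArg (fun v : syz f => (v : Fin 3 → PolyRing k)) this
  · intro v w hvw
    have := congrFun hvw 0
    rw [hφ₃, hφ₃] at this
    ext i : 1
    fin_cases i
    exact mul_right_cancel₀ hl0 this
  · rintro _ ⟨v, rfl⟩
    refine mem_irrelevantIdeal_smul_top.2 fun i => ?_
    rw [hφ₁]
    exact sum_mem fun a _ => Ideal.mul_mem_left _ _
      (mem_irrelevantIdeal_of_mem_piece (by omega) (hpd a))
  · rintro _ ⟨v, rfl⟩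
    refine mem_irrelevantIdeal_smul_top.2 fun i => ?_
    rw [hφ₂']
    exact add_mem (add_mem
      (Ideal.mul_mem_left _ _ (mem_irrelevantIdeal_of_mem_piece (by omega) (hg₁p i)))
      (Ideal.mul_mem_left _ _ (mem_irrelevantIdeal_of_mem_piece (by omega) (hg₂p i))))
      (Ideal.mul_mem_left _ _ (mem_irrelevantIdeal_of_mem_piece he0 (hεp i)))
  · rintro _ ⟨v, rfl⟩
    refine mem_irrelevantIdeal_smul_top.2 fun i => ?_
    rw [hφ₃]
    have h1 := mem_irrelevantIdeal_of_mem_piece (by norm_num) hlp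
    have h2 := mem_irrelevantIdeal_of_mem_piece (by norm_num) (neg_mem hqp)
    have h3 := mem_irrelevantIdeal_of_mem_piece (by omega) (neg_mem hm)
    fin_cases i
    · exact Ideal.mul_mem_left _ _ h1
    · exact Ideal.mul_mem_left _ _ h2
    · exact Ideal.mul_mem_left _ _ h3

/-! ### Presentations of the module of syzygies -/

/-- A presentation of `Syz(J_f)` by three generators `gᵢ` of degrees `bᵢ` and a single relation
`∑ rᵢ gᵢ = 0`, of degree `c` and with coefficients in the irrelevant ideal. The relation generates
all relations, and it is nonzero, so that this is a minimal graded free resolution of length one. -/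
structure SyzPresentation (f : PolyRing k) (b : Fin 3 → ℤ) (c : ℤ) where
  /-- The generators. -/
  gen : Fin 3 → syz f
  /-- The coefficients of the relation. -/
  rel : Fin 3 → PolyRing k
  gen_mem : ∀ i, (gen i : Fin 3 → PolyRing k) ∈ freePiece (k := k) (0 : Fin 3 → ℤ) (b i)
  rel_mem : ∀ i, rel i ∈ piece k (c - b i)
  rel_mem_irrelevantIdeal : ∀ i, rel i ∈ irrelevantIdeal k
  rel_ne_zero : rel ≠ 0
  exists_eq : ∀ w : syz f, ∃ v : Fin 3 → PolyRing k, ∑ i, v i • gen i = w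
  sum_eq_zero_iff : ∀ v : Fin 3 → PolyRing k, ∑ i, v i • gen i = 0 ↔ ∃ t : PolyRing k, v = t • rel

theorem linearMap_apply_eq_sum_single {n : ℕ} {M : Type*} [AddCommGroup M] [Module (PolyRing k) M]
    (φ : (Fin n → PolyRing k) →ₗ[PolyRing k] M) (v : Fin n → PolyRing k) :
    φ v = ∑ i, v i • φ (Pi.single i 1) := by
  conv_lhs => rw [pi_eq_sum_univ' v]
  simp only [map_sum, map_smul]

theorem single_mem_freePiece {n : ℕ} (a : Fin n → ℤ) (i : Fin n) :
    (Pi.single i 1 : Fin n → PolyRing k) ∈ freePiece a (a i) := by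
  refine mem_freePiece.2 fun j => ?_
  rcases eq_or_ne j i with rfl | h
  · rw [Pi.single_eq_same, sub_self, ← C_1]
    exact C_mem_piece_zero 1
  · rw [Pi.single_eq_of_ne h]
    exact zero_mem _

theorem C_mem_irrelevantIdeal {c : k} (h : C c ∈ irrelevantIdeal k) : c = 0 := by
  simpa [mem_irrelevantIdeal_iff] using h

/-- Coefficients expressing a form of degree `d` through forms of degree `d` can be taken to
be constants. -/
theorem exists_C_coeff {n : ℕ} {d : ℤ} {h : Fin n → PolyRing k} (hh : ∀ i, h i ∈ piece k d)
    {p : PolyRing k} (hp : p ∈ piece k d) {r : Fin n → PolyRing k} (hr : ∑ i, r i * h i = p) :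
    ∃ c : Fin n → k, ∑ i, C (c i) * h i = p := by
  choose c hc using fun i => exists_C_of_mem_piece_zero (intComponent_mem 0 (r i))
  refine ⟨c, ?_⟩
  have := congrArg (intComponent (k := k) (0 + d)) hr
  rw [map_sum, zero_add, intComponent_of_mem hp] at this
  rw [← this]
  refine Finset.sum_congr rfl fun i _ => ?_
  rw [← hc, ← intComponent_mul (hh i), zero_add]

/-- Two triples of polynomials that are combinations of each other with constant coefficients differ
by an invertible constant matrix, if one of them is linearly independent. -/
theorem exists_change_of_generators {h F : Fin 3 → PolyRing k}
    (hindep : ∀ x : Fin 3 → k, (fun i => C (x i)) ⬝ᵥ h = 0 → x = 0)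
    (hA : ∀ i, ∃ a : Fin 3 → k, ∑ j, C (a j) * F j = h i)
    (hB : ∀ i, ∃ a : Fin 3 → k, ∑ j, C (a j) * h j = F i) :
    ∃ A B : Matrix (Fin 3) (Fin 3) (PolyRing k), (∀ i j, A i j ∈ piece k 0) ∧ A * B = 1 ∧
      B * A = 1 ∧ A.mulVec F = h ∧ B.mulVec h = F := by
  choose A hA using hA
  choose B hB using hB
  have hAF : ((Matrix.of A).map C).mulVec F = h := funext hA
  have hBh : ((Matrix.of B).map C).mulVec h = F := funext hB
  have hAB : Matrix.of A * Matrix.of B = 1 := by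
    rw [← sub_eq_zero]
    refine funext fun i => hindep _ ?_
    have h1 : ((Matrix.of A * Matrix.of B - 1).map C).mulVec h = 0 := by
      rw [Matrix.map_sub C (fun _ _ => C_sub ..), Matrix.map_mul, Matrix.sub_mulVec,
        ← Matrix.mulVec_mulVec, hBh, hAF, Matrix.map_one C C_0 C_1, Matrix.one_mulVec, sub_self]
    exact congrFun h1 i
  have hBA : Matrix.of B * Matrix.of A = 1 := mul_eq_one_comm.1 hAB
  refine ⟨(Matrix.of A).map C, (Matrix.of B).map C, fun i j => C_mem_piece_zero (A i j), ?_, ?_,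
    hAF, hBh⟩
  · rw [← Matrix.map_mul, hAB, Matrix.map_one C C_0 C_1]
  · rw [← Matrix.map_mul, hBA, Matrix.map_one C C_0 C_1]

/-- A minimal free resolution of `R/J_f` whose first map has degree `d` yields a presentation of
`Syz(J_f)`: its first map is given by generators of `J_f` of degree `d`, which differ from
the partial derivatives by an invertible constant matrix. -/
theorem exists_syzPresentation {f : PolyRing k} {d : ℕ} (hf : f.IsHomogeneous (d + 1))
    {a₂ : Fin 3 → ℤ} {a₃ : Fin 1 → ℤ}
    (h : HasMinimalGradedFreeResolution (gradientIdeal f) ![0] ![(d : ℤ), (d : ℤ), (d : ℤ)]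
      a₂ a₃) : Nonempty (SyzPresentation f (fun i => a₂ i - d) (a₃ 0 - d)) := by
  obtain ⟨π, φ₁, φ₂, φ₃, hπg, hφ₁g, hφ₂g, hφ₃g, hπs, hex₁, hex₂, hex₃, hinj, hm₁, hm₂, hm₃⟩ := h
  have ha₁ : ∀ i, (![(d : ℤ), (d : ℤ), (d : ℤ)] : Fin 3 → ℤ) i = d := by
    intro i
    fin_cases i <;> rfl
  set h : Fin 3 → PolyRing k := fun i => φ₁ (Pi.single i 1) 0 with hh
  set F : Fin 3 → PolyRing k := fun i => pderiv i f with hF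
  have hhd : ∀ i, h i ∈ piece k (d : ℤ) := fun i => by
    have := mem_freePiece.1 (hφ₁g _ _ (single_mem_freePiece _ i)) 0
    exact mem_piece_of_eq (by rw [ha₁]; simp) this
  have hFd : ∀ i, F i ∈ piece k (d : ℤ) := fun i => mem_piece_natCast.2 hf.pderiv
  have hφ₁ : ∀ v, φ₁ v 0 = v ⬝ᵥ h := by
    intro v
    rw [linearMap_apply_eq_sum_single, Finset.sum_apply]
    rfl
  have hφ₁0 : ∀ v, φ₁ v = 0 ↔ v ⬝ᵥ h = 0 := by
    intro v
    rw [← hφ₁]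
    refine ⟨fun h => congrFun h 0, fun h => funext fun i => ?_⟩
    fin_cases i
    exact h
  -- The augmentation is the quotient map up to a nonzero constant, so that `φ₁` has image `J_f`.
  obtain ⟨p, hp, hπ1⟩ := hπg 0 (Pi.single 0 1) (single_mem_freePiece ![0] 0)
  obtain ⟨c, rfl⟩ := exists_C_of_mem_piece_zero hp
  have hπ : ∀ p : PolyRing k, π (fun _ => p) = Ideal.Quotient.mk (gradientIdeal f) (p * C c) := by
    intro p
    rw [linearMap_apply_eq_sum_single, Fin.sum_univ_one, ← hπ1]
    exact (Submodule.Quotient.mk_smul _ p (C c)).symm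
  have hc0 : c ≠ 0 := by
    rintro rfl
    have h1 : π (fun _ => 1) = 0 := by rw [hπ, C_0, mul_zero, map_zero]
    have h2 := hm₁ (((hex₁ _).1 h1 : _ ∈ LinearMap.range φ₁))
    exact one_notMem_irrelevantIdeal (mem_irrelevantIdeal_smul_top.1 h2 0)
  have hcu : IsUnit (C c : PolyRing k) := (isUnit_iff_ne_zero.2 hc0).map C
  have himage : ∀ p, p ∈ gradientIdeal f ↔ ∃ v : Fin 3 → PolyRing k, ∑ i, v i * h i = p := by
    intro p
    rw [← Ideal.mul_unit_mem_iff_mem _ hcu, ← Ideal.Quotient.eq_zero_iff_mem, ← hπ, hex₁]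
    constructor
    · rintro ⟨v, hv⟩
      exact ⟨v, (hφ₁ v).symm.trans (congrFun hv 0)⟩
    · rintro ⟨v, hv⟩
      refine ⟨v, funext fun i => ?_⟩
      fin_cases i
      exact (hφ₁ v).trans hv
  have hA : ∀ i, ∃ a : Fin 3 → k, ∑ j, C (a j) * F j = h i := by
    intro i
    have hi : h i ∈ gradientIdeal f := (himage _).2 ⟨Pi.single i 1, by simp [Pi.single_apply]⟩
    rw [gradientIdeal, Ideal.mem_span_range_iff_exists_fun] at hi
    obtain ⟨r, hr⟩ := hi
    exact exists_C_coeff hFd (hhd i) hr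
  have hB : ∀ i, ∃ a : Fin 3 → k, ∑ j, C (a j) * h j = F i := by
    intro i
    obtain ⟨r, hr⟩ := (himage (F i)).1 (Ideal.subset_span ⟨i, rfl⟩)
    exact exists_C_coeff hhd (hFd i) hr
  -- A constant relation among the `h i` is in the image of `φ₂`, so it vanishes by minimality.
  have hindep : ∀ x : Fin 3 → k, (fun i => C (x i)) ⬝ᵥ h = 0 → x = 0 := by
    intro x hx
    have h2 := hm₂ (((hex₂ _).1 ((hφ₁0 _).2 hx) : _ ∈ LinearMap.range φ₂))
    exact funext fun i => C_mem_irrelevantIdeal (mem_irrelevantIdeal_smul_top.1 h2 i)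
  obtain ⟨A', B', hA0, hAB', hBA', hAF, hBh⟩ := exists_change_of_generators hindep hA hB
  have hsyz : ∀ v, v ∈ syz f ↔ v ⬝ᵥ F = 0 := fun v => mem_syz
  have hφφ : ∀ v, Matrix.vecMul (φ₂ v) A' ∈ syz f := by
    intro v
    rw [hsyz, ← Matrix.dotProduct_mulVec, hAF, ← hφ₁0]
    exact (hex₂ _).2 ⟨v, rfl⟩
  let ψ : (Fin 3 → PolyRing k) →ₗ[PolyRing k] syz f :=
    LinearMap.codRestrict (syz f) (A'.vecMulLinear ∘ₗ φ₂) hφφ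
  have hψ : ∀ v, (ψ v : Fin 3 → PolyRing k) = Matrix.vecMul (φ₂ v) A' := fun v => rfl
  have hsum : ∀ v : Fin 3 → PolyRing k, ∑ i, v i • ψ (Pi.single i 1) = ψ v := fun v =>
    (linearMap_apply_eq_sum_single ψ v).symm
  have hφ₃ : ∀ t, φ₃ t = t 0 • φ₃ (Pi.single 0 1) := fun t => by
    rw [linearMap_apply_eq_sum_single, Fin.sum_univ_one]
  refine ⟨⟨fun i => ψ (Pi.single i 1), φ₃ (Pi.single 0 1), ?_, ?_, ?_, ?_, ?_, ?_⟩⟩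
  · intro i
    refine mem_freePiece.2 fun j => ?_
    have h1 := mem_freePiece.1 (hφ₂g _ _ (single_mem_freePiece a₂ i))
    have h2 : (ψ (Pi.single i 1) : Fin 3 → PolyRing k) j =
        ∑ l, φ₂ (Pi.single i 1) l * A' l j := rfl
    rw [h2]
    refine mem_piece_of_eq (i := a₂ i - d) (by simp) (sum_mem fun l _ => ?_)
    have := mul_mem_piece (h1 l) (hA0 l j)
    rwa [ha₁, add_zero] at this
  · intro i
    have := mem_freePiece.1 (hφ₃g _ _ (single_mem_freePiece a₃ 0)) i
    exact mem_piece_of_eq (by ring) this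
  · exact mem_irrelevantIdeal_smul_top.1 (hm₃ (LinearMap.mem_range_self φ₃ _))
  · intro h0
    have h1 := hinj (h0.trans (map_zero φ₃).symm)
    simpa using congrFun h1 0
  · intro w
    have h1 : φ₁ (Matrix.vecMul (w : Fin 3 → PolyRing k) B') = 0 := by
      rw [hφ₁0, ← Matrix.dotProduct_mulVec, hBh]
      exact (hsyz _).1 w.2
    obtain ⟨v, hv⟩ := (hex₂ _).1 h1
    refine ⟨v, (hsum v).trans (Subtype.ext ?_)⟩
    rw [hψ, hv, Matrix.vecMul_vecMul, hBA', Matrix.vecMul_one]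
  · intro v
    have h1 : ∑ i, v i • ψ (Pi.single i 1) = 0 ↔ φ₂ v = 0 := by
      rw [hsum]
      constructor
      · intro h0
        have h2 : Matrix.vecMul (φ₂ v) A' = 0 := congrArg Subtype.val h0
        rw [← Matrix.vecMul_one (φ₂ v), ← hAB', ← Matrix.vecMul_vecMul, h2, Matrix.zero_vecMul]
      · intro h0
        refine Subtype.ext ?_
        rw [hψ, h0, Matrix.zero_vecMul]
        rfl
    rw [h1, hex₃]
    constructor
    · rintro ⟨t, rfl⟩
      exact ⟨t 0, hφ₃ t⟩
    · rintro ⟨t, rfl⟩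
      exact ⟨fun _ => t, hφ₃ _⟩

namespace SyzPresentation

variable {f : PolyRing k} {b : Fin 3 → ℤ} {c : ℤ}

theorem gen_ne_zero (P : SyzPresentation f b c) (i : Fin 3) : P.gen i ≠ 0 := by
  intro h
  obtain ⟨t, ht⟩ := (P.sum_eq_zero_iff (Pi.single i 1)).1 (by
    rw [Finset.sum_eq_single i (fun j _ hj => by rw [Pi.single_eq_of_ne hj, zero_smul])
      (fun hi => absurd (Finset.mem_univ i) hi), h, smul_zero])
  have := congrFun ht i
  rw [Pi.single_eq_same, Pi.smul_apply, smul_eq_mul] at this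
  exact one_notMem_irrelevantIdeal (this ▸ Ideal.mul_mem_left _ _ (P.rel_mem_irrelevantIdeal i))

/-- A splitting of the presentation would express `1` through the coefficients of the minimal
relation. -/
theorem not_isFreeDivisor (P : SyzPresentation f b c) : ¬ IsFreeDivisor f := by
  intro hfree
  have : Module.Free (PolyRing k) (syz f) := hfree
  let p : (Fin 3 → PolyRing k) →ₗ[PolyRing k] syz f := Fintype.linearCombination _ P.gen
  have hp : ∀ v, p v = ∑ i, v i • P.gen i := fun v => Fintype.linearCombination_apply _ _ v
  obtain ⟨s, hs⟩ := Module.projective_lifting_property p LinearMap.id fun w => P.exists_eq w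
  have hs' : ∀ w, p (s w) = w := fun w => LinearMap.congr_fun hs w
  have ht : ∀ v, ∃ t : PolyRing k, v - s (p v) = t • P.rel := fun v => by
    rw [← P.sum_eq_zero_iff, ← hp, map_sub, hs', sub_self]
  choose t ht using fun i => ht (Pi.single i 1)
  have hrel : P.rel = (∑ i, P.rel i * t i) • P.rel := by
    have h0 : p P.rel = 0 := by
      rw [hp, P.sum_eq_zero_iff]
      exact ⟨1, (one_smul _ _).symm⟩
    have h1 := linearMap_apply_eq_sum_single (LinearMap.id - s ∘ₗ p) P.rel
    simp only [LinearMap.sub_apply, LinearMap.comp_apply, LinearMap.id_apply, ht, h0, map_zero,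
      sub_zero, smul_smul] at h1
    rwa [← Finset.sum_smul] at h1
  have h1 : (1 - ∑ i, P.rel i * t i) • P.rel = 0 := by
    rw [sub_smul, one_smul, ← hrel, sub_self]
  have h2 := (smul_eq_zero.1 h1).resolve_right P.rel_ne_zero
  rw [sub_eq_zero] at h2
  refine one_notMem_irrelevantIdeal (k := k) ?_
  rw [h2]
  exact sum_mem fun i _ => Ideal.mul_mem_right _ _ (P.rel_mem_irrelevantIdeal i)

/-- The coefficients of a homogeneous syzygy in terms of the generators can be replaced by their
components of the right degrees. -/
theorem sum_intComponent_smul (P : SyzPresentation f b c) {j : ℤ} {w : syz f}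
    (hw : (w : Fin 3 → PolyRing k) ∈ freePiece (k := k) (0 : Fin 3 → ℤ) j)
    {v : Fin 3 → PolyRing k} (hv : ∑ i, v i • P.gen i = w) :
    ∑ i, intComponent (j - b i) (v i) • P.gen i = w := by
  refine Subtype.ext (funext fun a => ?_)
  have h1 := congrFun (congrArg (fun w : syz f => (w : Fin 3 → PolyRing k)) hv) a
  simp only [AddSubmonoidClass.coe_finsetSum, Finset.sum_apply, SetLike.val_smul, Pi.smul_apply,
    smul_eq_mul] at h1 ⊢
  have h2 := congrArg (intComponent (k := k) j) h1
  have hwa : (w : Fin 3 → PolyRing k) a ∈ piece k j := by simpa using mem_freePiece.1 hw a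
  rw [map_sum, intComponent_of_mem hwa] at h2
  rw [← h2]
  refine Finset.sum_congr rfl fun i _ => ?_
  have hg : (P.gen i : Fin 3 → PolyRing k) a ∈ piece k (b i) := by
    simpa using mem_freePiece.1 (P.gen_mem i) a
  rw [← intComponent_mul hg, sub_add_cancel]

end SyzPresentation

/-! ### Syzygies of minimal degree -/

theorem isUnit_of_totalDegree_eq_zero {a : PolyRing k} (ha : a ≠ 0) (h : a.totalDegree = 0) :
    IsUnit a := by
  rw [totalDegree_eq_zero_iff_eq_C] at h
  rw [h] at ha ⊢
  exact (isUnit_iff_ne_zero.2 fun h0 => ha (by rw [h0, C_0])).map C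

/-- A nonzero syzygy of minimal degree is primitive: its coordinates have no common factor. -/
theorem isUnit_of_smul_eq {f : PolyRing k} {d : ℕ} (hf : f.IsHomogeneous (d + 1)) {ε : syz f}
    (hε : ε ≠ 0)
    (hεe : (ε : Fin 3 → PolyRing k) ∈ freePiece (k := k) (0 : Fin 3 → ℤ) (indegSyz f))
    {h : PolyRing k} {v : Fin 3 → PolyRing k} (hv : h • v = (ε : Fin 3 → PolyRing k)) :
    IsUnit h := by
  have hε' : (ε : Fin 3 → PolyRing k) ≠ 0 := fun h => hε (Subtype.ext h)
  have hh0 : h ≠ 0 := by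
    rintro rfl
    rw [zero_smul] at hv
    exact hε' hv.symm
  have hv0 : v ≠ 0 := by
    rintro rfl
    rw [smul_zero] at hv
    exact hε' hv.symm
  have hvs : v ∈ syz f := mem_syz_of_smul_mem h v hh0 (hv ▸ ε.2)
  obtain ⟨S, hS⟩ := exists_vecComponent_eq_zero (0 : Fin 3 → ℤ) v
  obtain ⟨j, hj⟩ : ∃ j, vecComponent (0 : Fin 3 → ℤ) j v ≠ 0 := by
    by_contra! hne
    refine hv0 ?_
    rw [← sum_vecComponent hS]
    exact Finset.sum_eq_zero fun j _ => hne j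
  -- A nonzero component of `v` has degree at least `indegSyz f` and at most the degree of `ε`
  -- minus the degree of `h`, so `h` is a constant.
  have hle := indegSyz_le (vecComponent_mem_syz hf j hvs) hj (vecComponent_mem _ j v)
  obtain ⟨i, hi⟩ := Function.ne_iff.1 hj
  have hi' : homogeneousComponent j.toNat (v i) ≠ 0 := by
    simpa [intComponent, show 0 ≤ j by omega] using hi
  have hvi : v i ≠ 0 := fun h0 => hi' (by rw [h0, map_zero])
  have hdeg : j.toNat ≤ (v i).totalDegree := by
    by_contra! hlt
    exact hi' (homogeneousComponent_eq_zero _ _ hlt)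
  have hεi : ((ε : Fin 3 → PolyRing k) i).totalDegree ≤ indegSyz f := by
    have := mem_freePiece.1 hεe i
    rw [Pi.zero_apply, sub_zero, mem_piece_natCast] at this
    exact this.totalDegree_le
  rw [← hv, Pi.smul_apply, smul_eq_mul, totalDegree_mul_of_isDomain hh0 hvi] at hεi
  exact isUnit_of_totalDegree_eq_zero hh0 (by omega)

/-- The submodule generated by a nonzero syzygy of minimal degree is saturated in `Syz(J_f)`. -/
theorem exists_eq_smul_of_smul_eq_smul {f : PolyRing k} {d : ℕ} (hf : f.IsHomogeneous (d + 1))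
    {ε : syz f} (hε : ε ≠ 0)
    (hεe : (ε : Fin 3 → PolyRing k) ∈ freePiece (k := k) (0 : Fin 3 → ℤ) (indegSyz f))
    {h s : PolyRing k} (hh : h ≠ 0) {w : syz f} (hw : h • w = s • ε) :
    ∃ t : PolyRing k, w = t • ε := by
  obtain ⟨h', s', c, hrel, rfl, rfl⟩ := UniqueFactorizationMonoid.exists_reduced_factors h hh s
  have hc : c ≠ 0 := left_ne_zero_of_mul hh
  have hw' : h' • w = s' • ε := by
    rw [mul_smul, mul_smul] at hw
    exact smul_right_injective _ hc hw
  have hdvd : ∀ i, h' ∣ (ε : Fin 3 → PolyRing k) i := fun i =>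
    hrel.dvd_of_dvd_mul_left ⟨(w : Fin 3 → PolyRing k) i,
      (congrFun (congrArg (fun w : syz f => (w : Fin 3 → PolyRing k)) hw') i).symm⟩
  choose v hv using hdvd
  obtain ⟨a, rfl⟩ := isUnit_of_smul_eq hf hε hεe (h := h') (v := v) (funext fun i => (hv i).symm)
  refine ⟨(↑a⁻¹ : PolyRing k) * s', ?_⟩
  rw [mul_smul, ← hw', smul_smul, Units.inv_mul, one_smul]

/-! ### Bourbaki ideals of presented modules of syzygies -/

namespace SyzPresentation

variable {f : PolyRing k} {d : ℕ}

theorem indegSyz_le_degree {b : Fin 3 → ℤ} {c : ℤ} (P : SyzPresentation f b c) (i : Fin 3) :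
    (indegSyz f : ℤ) ≤ b i :=
  indegSyz_le (P.gen i).2 (fun h => P.gen_ne_zero i (Subtype.ext h)) (P.gen_mem i)

/-- With generators of degrees `d - e + 2`, `d - e + 1` and `e`, every Bourbaki ideal with
respect to a syzygy of degree `e` is generated by a quadratic and a linear form. The syzygy need not
be a multiple of the third generator if `d - e + 1 = e`. -/
theorem exists_span_of_isBourbakiIdeal {e : ℕ}
    (P : SyzPresentation f ![(d : ℤ) - e + 2, d - e + 1, e] (d - e + 3))
    (hed : (e : ℤ) ≤ d - e + 1) {ε : syz f} {I : Ideal (PolyRing k)} (hε : ε ≠ 0)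
    (hεe : (ε : Fin 3 → PolyRing k) ∈ freePiece (k := k) (0 : Fin 3 → ℤ) e)
    (hB : IsBourbakiIdeal d e f ε I) :
    ∃ q ∈ piece k 2, ∃ l ∈ piece k 1, I = Ideal.span {q, l} := by
  obtain ⟨u, hker, hrange, hu⟩ := hB.exists_sequence
  have huε : u ε = 0 := by
    rw [← LinearMap.mem_ker, hker]
    exact Submodule.mem_span_singleton_self ε
  have hu0 : u (P.gen 0) ∈ piece k 2 := mem_piece_of_eq (by simp; ring) (hu _ _ (P.gen_mem 0))
  have hu1 : u (P.gen 1) ∈ piece k 1 := mem_piece_of_eq (by simp; ring) (hu _ _ (P.gen_mem 1))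
  have hu2 : u (P.gen 2) ∈ piece k (e + (e - d)) :=
    mem_piece_of_eq (by simp) (hu _ _ (P.gen_mem 2))
  have hI : ∀ p, p ∈ I ↔ ∃ v : Fin 3 → PolyRing k,
      v 0 * u (P.gen 0) + v 1 * u (P.gen 1) + v 2 * u (P.gen 2) = p := by
    intro p
    rw [← hrange, LinearMap.mem_range]
    constructor
    · rintro ⟨w, rfl⟩
      obtain ⟨v, rfl⟩ := P.exists_eq w
      exact ⟨v, by simp [Fin.sum_univ_three]⟩
    · rintro ⟨v, rfl⟩
      exact ⟨∑ i, v i • P.gen i, by simp [Fin.sum_univ_three]⟩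
  -- For degree reasons `ε = c₁ g₁ + c₂ g₂` with constants `c₁`, `c₂`.
  obtain ⟨v, hv⟩ := P.exists_eq ε
  have hv' := P.sum_intComponent_smul hεe hv
  rw [Fin.sum_univ_three] at hv'
  simp only [Matrix.cons_val] at hv'
  have h0 : intComponent ((e : ℤ) - (d - e + 2)) (v 0) = 0 :=
    eq_zero_of_mem_piece_neg (by omega) (intComponent_mem _ _)
  rw [h0, zero_smul, zero_add, sub_self] at hv'
  obtain ⟨c₂, hc₂⟩ := exists_C_of_mem_piece_zero (intComponent_mem 0 (v 2))
  rw [hc₂] at hv'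
  rcases eq_or_ne c₂ 0 with rfl | hc
  · rw [C_0, zero_smul, add_zero] at hv'
    rcases lt_or_eq_of_le hed with hlt | heq
    · rw [eq_zero_of_mem_piece_neg (by omega) (intComponent_mem _ (v 1)), zero_smul] at hv'
      exact absurd hv'.symm hε
    · obtain ⟨c₁, hc₁⟩ := exists_C_of_mem_piece_zero
        (mem_piece_of_eq (by omega : (e : ℤ) - (d - e + 1) = 0) (intComponent_mem _ (v 1)))
      rw [hc₁] at hv'
      have hc₁0 : (C c₁ : PolyRing k) ≠ 0 := by
        intro h
        rw [h, zero_smul] at hv'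
        exact hε hv'.symm
      have hu10 : u (P.gen 1) = 0 := by
        rw [← hv', map_smul, smul_eq_mul] at huε
        exact (mul_eq_zero.1 huε).resolve_left hc₁0
      refine ⟨_, hu0, _, mem_piece_of_eq (by omega) hu2, ?_⟩
      ext p
      rw [hI, Ideal.mem_span_pair, hu10]
      constructor
      · rintro ⟨v, hv⟩
        exact ⟨v 0, v 2, by linear_combination hv⟩
      · rintro ⟨a, b, hab⟩
        exact ⟨![a, 0, b], by simpa using hab⟩
  · have hcc : (C c₂⁻¹ : PolyRing k) * C c₂ = 1 := by rw [← C_mul, inv_mul_cancel₀ hc, C_1]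
    rw [← hv', map_add, map_smul, map_smul, smul_eq_mul, smul_eq_mul] at huε
    refine ⟨_, hu0, _, hu1, ?_⟩
    ext p
    rw [hI, Ideal.mem_span_pair]
    constructor
    · rintro ⟨w, hw⟩
      refine ⟨w 0, w 1 - w 2 * C c₂⁻¹ * intComponent ((e : ℤ) - (d - e + 1)) (v 1), ?_⟩
      linear_combination hw - w 2 * C c₂⁻¹ * huε + w 2 * u (P.gen 2) * hcc
    · rintro ⟨a, b, hab⟩
      exact ⟨![a, b, 0], by simpa using hab⟩

/-- With generators of degrees `d - e + 2`, `d - e + 1` and `e`, every Bourbaki ideal has degree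
two. -/
theorem degQuot_eq_two {e : ℕ}
    (P : SyzPresentation f ![(d : ℤ) - e + 2, d - e + 1, e] (d - e + 3))
    (hed : (e : ℤ) ≤ d - e + 1) {ε : syz f} {I : Ideal (PolyRing k)} (hε : ε ≠ 0)
    (hεe : (ε : Fin 3 → PolyRing k) ∈ freePiece (k := k) (0 : Fin 3 → ℤ) e)
    (hB : IsBourbakiIdeal d e f ε I) : degQuot I = 2 := by
  have hI2 := hB.height_eq_two P.not_isFreeDivisor
  obtain ⟨q, hq, l, hl, rfl⟩ := P.exists_span_of_isBourbakiIdeal hed hε hεe hB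
  have hrel := isRelPrime_of_height_span_pair hI2
  have hq0 : q ≠ 0 := by
    rintro rfl
    refine not_le_span_of_height_eq_two hI2 (p := l) (fun hu => ?_) ?_
    · have ht : Ideal.span {(0 : PolyRing k), l} = ⊤ :=
        Ideal.eq_top_of_isUnit_mem _ (Ideal.subset_span (by simp)) hu
      rw [ht, Ideal.height_top] at hI2
      exact absurd hI2 (by decide)
    · refine Ideal.span_le.2 ?_
      rintro x (rfl | rfl)
      · exact zero_mem _
      · exact Ideal.mem_span_singleton_self _
  have h := degQuot_of_hilbertFunction (I := Ideal.span {q, l}) (c := 2) (by norm_num)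
    (Filter.eventually_atTop.2 ⟨1, fun n hn => by
      rw [hilbertFunction_span_pair (a := 2) (b := 1) (isHomogeneous_of_mem_piece hq)
        (isHomogeneous_of_mem_piece hl) hq0 hrel (by omega)]⟩)
  exact_mod_cast h

/-- The first two coefficients of the relation are coprime since the third generator is a syzygy of
minimal degree. -/
theorem isRelPrime_rel {e : ℕ} {b : Fin 3 → ℤ} {c : ℤ} (P : SyzPresentation f b c)
    (hf : f.IsHomogeneous (d + 1)) (he : e = indegSyz f) (hb : b 2 = e) :
    IsRelPrime (P.rel 0) (P.rel 1) := by
  have hsum : P.rel 0 • P.gen 0 + P.rel 1 • P.gen 1 + P.rel 2 • P.gen 2 = 0 := by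
    rw [← Fin.sum_univ_three (fun i => P.rel i • P.gen i), P.sum_eq_zero_iff]
    exact ⟨1, (one_smul _ _).symm⟩
  have h01 : ¬ (P.rel 0 = 0 ∧ P.rel 1 = 0) := by
    rintro ⟨h0, h1⟩
    rw [h0, h1, zero_smul, zero_smul, zero_add, zero_add] at hsum
    have h2 := (smul_eq_zero.1 hsum).resolve_right (P.gen_ne_zero 2)
    refine P.rel_ne_zero (funext fun i => ?_)
    fin_cases i
    exacts [h0, h1, h2]
  rintro h ⟨m₀, hm₀⟩ ⟨m₁, hm₁⟩
  have hh : h ≠ 0 := by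
    rintro rfl
    exact h01 ⟨by rw [hm₀, zero_mul], by rw [hm₁, zero_mul]⟩
  have hw : h • (m₀ • P.gen 0 + m₁ • P.gen 1) = (-P.rel 2) • P.gen 2 := by
    rw [smul_add, smul_smul, smul_smul, ← hm₀, ← hm₁, ← sub_eq_zero, ← hsum]
    module
  obtain ⟨t, ht⟩ := exists_eq_smul_of_smul_eq_smul hf (P.gen_ne_zero 2)
    (he ▸ hb ▸ P.gen_mem 2) hh hw
  obtain ⟨s, hs⟩ := (P.sum_eq_zero_iff ![m₀, m₁, -t]).1 (by
    rw [Fin.sum_univ_three]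
    simp only [Matrix.cons_val]
    rw [ht]
    module)
  have hs0 : m₀ = s * P.rel 0 := congrFun hs 0
  have hs1 : m₁ = s * P.rel 1 := congrFun hs 1
  refine IsUnit.of_mul_eq_one s ?_
  by_cases h0 : P.rel 0 = 0
  · refine mul_right_cancel₀ (fun h1 => h01 ⟨h0, h1⟩ : P.rel 1 ≠ 0) ?_
    rw [mul_assoc, ← hs1, ← hm₁, one_mul]
  · refine mul_right_cancel₀ h0 ?_
    rw [mul_assoc, ← hs0, ← hm₀, one_mul]

/-- With generators of degrees `d - e + 2`, `d - e + 1` and `e`, the first two coefficients of the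
relation generate a Bourbaki ideal for the third generator. -/
theorem isBourbakiIdeal {e : ℕ}
    (P : SyzPresentation f ![(d : ℤ) - e + 2, d - e + 1, e] (d - e + 3))
    (hf : f.IsHomogeneous (d + 1)) (he : e = indegSyz f) :
    IsBourbakiIdeal d e f (P.gen 2) (Ideal.span {P.rel 0, P.rel 1}) := by
  have hrel := P.isRelPrime_rel hf he rfl
  have hr0 : P.rel 0 ∈ piece k (1 : ℤ) := mem_piece_of_eq (by simp) (P.rel_mem 0)
  have hr1 : P.rel 1 ∈ piece k (2 : ℤ) := mem_piece_of_eq (by simp) (P.rel_mem 1)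
  have hr00 : P.rel 0 ≠ 0 := by
    intro h0
    rw [h0, isRelPrime_zero_left] at hrel
    exact one_notMem_irrelevantIdeal ((Ideal.eq_top_iff_one _).1
      (Ideal.eq_top_of_isUnit_mem _ (P.rel_mem_irrelevantIdeal 1) hrel))
  have hle : Ideal.span {P.rel 0, P.rel 1} ≤ irrelevantIdeal k := by
    refine Ideal.span_le.2 ?_
    rintro x (rfl | rfl)
    exacts [P.rel_mem_irrelevantIdeal 0, P.rel_mem_irrelevantIdeal 1]
  refine ⟨?_, fun h => absurd h P.not_isFreeDivisor, fun _ => ?_, ?_⟩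
  · refine Ideal.homogeneous_span _ _ ?_
    rintro x (rfl | rfl)
    exacts [⟨_, isHomogeneous_of_mem_piece hr0⟩, ⟨_, isHomogeneous_of_mem_piece hr1⟩]
  · exact height_span_pair hr00 hrel fun h => one_notMem_irrelevantIdeal
      (hle (h ▸ Submodule.mem_top))
  let p : (Fin 3 → PolyRing k) →ₗ[PolyRing k] syz f := Fintype.linearCombination _ P.gen
  have hp : ∀ v, p v = ∑ i, v i • P.gen i := fun v => Fintype.linearCombination_apply _ _ v
  have hpsurj : Function.Surjective p := fun w => P.exists_eq w
  -- The map `Syz → R` is induced by `v ↦ v₀ r₁ - v₁ r₀`, which kills the relation `r`.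
  let T : (Fin 3 → PolyRing k) →ₗ[PolyRing k] PolyRing k :=
    P.rel 1 • LinearMap.proj 0 - P.rel 0 • LinearMap.proj 1
  have hT : ∀ v, T v = P.rel 1 * v 0 - P.rel 0 * v 1 := fun v => rfl
  have hTker : LinearMap.ker p ≤ LinearMap.ker T := by
    intro v hv
    rw [LinearMap.mem_ker, hp, P.sum_eq_zero_iff] at hv
    obtain ⟨t, rfl⟩ := hv
    rw [LinearMap.mem_ker, hT]
    simp only [Pi.smul_apply, smul_eq_mul]
    ring
  let u : syz f →ₗ[PolyRing k] PolyRing k :=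
    (LinearMap.ker p).liftQ T hTker ∘ₗ (p.quotKerEquivOfSurjective hpsurj).symm.toLinearMap
  have hu : ∀ v, u (p v) = T v := by
    intro v
    have : (p.quotKerEquivOfSurjective hpsurj).symm (p v) = (LinearMap.ker p).mkQ v := by
      rw [LinearEquiv.symm_apply_eq]
      rfl
    simp only [u, LinearMap.comp_apply, LinearEquiv.coe_coe, this]
    exact (LinearMap.ker p).liftQ_apply T v
  refine ⟨u, ?_, ?_, ?_⟩
  · ext w
    obtain ⟨v, rfl⟩ := hpsurj w
    rw [LinearMap.mem_ker, hu, hT, Submodule.mem_span_singleton]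
    constructor
    · intro h
      obtain ⟨t, ht⟩ := hrel.dvd_of_dvd_mul_right
        (⟨v 1, by linear_combination h⟩ : P.rel 0 ∣ v 0 * P.rel 1)
      have ht1 : v 1 = t * P.rel 1 := by
        refine mul_left_cancel₀ hr00 ?_
        rw [ht] at h
        linear_combination -h
      refine ⟨v 2 - t * P.rel 2, ?_⟩
      have h0 : p (t • P.rel) = 0 := by
        rw [hp, P.sum_eq_zero_iff]
        exact ⟨t, rfl⟩
      rw [← sub_zero (p v), ← h0, ← map_sub, hp, Fin.sum_univ_three]
      simp only [Pi.sub_apply, Pi.smul_apply, smul_eq_mul]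
      rw [ht, ht1, mul_comm (P.rel 0), sub_self, sub_self, zero_smul, zero_smul, zero_add, zero_add]
    · rintro ⟨a, ha⟩
      have h2 : p (Pi.single 2 a) = p v := by
        rw [← ha, hp, Fin.sum_univ_three]
        simp
      rw [← hT, ← hu, ← h2, hu, hT]
      simp
  · ext x
    rw [LinearMap.mem_range, Ideal.mem_span_pair]
    constructor
    · rintro ⟨w, rfl⟩
      obtain ⟨v, rfl⟩ := hpsurj w
      exact ⟨-v 1, v 0, by rw [hu, hT]; ring⟩
    · rintro ⟨a, b, rfl⟩
      refine ⟨p ![b, -a, 0], ?_⟩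
      rw [hu, hT]
      simp only [Matrix.cons_val]
      ring
  · intro j w hw
    obtain ⟨v, hv⟩ := P.exists_eq w
    have hv' := P.sum_intComponent_smul hw hv
    rw [← hp] at hv'
    rw [← hv', hu, hT]
    simp only [Matrix.cons_val]
    refine sub_mem ?_ ?_
    · exact mem_piece_of_eq (by ring) (mul_mem_piece hr1 (intComponent_mem _ _))
    · exact mem_piece_of_eq (by ring) (mul_mem_piece hr0 (intComponent_mem _ _))

end SyzPresentation

end PlaneCurve

end

theorem mainTheorem5 {k : Type*} [Field k] [IsAlgClosed k] (d e : ℕ)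
    (hchar : ((d + 1 : ℕ) : k) ≠ 0)
    (f : PlaneCurve.PolyRing k) (hf : f.IsHomogeneous (d + 1)) (hf0 : f ≠ 0)
    (hred : (Ideal.span {f}).IsRadical) (hsing : PlaneCurve.IsSingular f)
    (he : e = PlaneCurve.indegSyz f) :
    (PlaneCurve.bourbakiDegree d f = 2 ↔
      PlaneCurve.HasMinimalGradedFreeResolution (PlaneCurve.gradientIdeal f)
        ![0]
        ![(d : ℤ), (d : ℤ), (d : ℤ)]
        ![(d : ℤ) + (d - e + 2), (d : ℤ) + (d - e + 1), (d : ℤ) + e]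
        ![(d : ℤ) + (d - e + 3)]) ∧
    (PlaneCurve.bourbakiDegree d f = 2 → (e : ℝ) ≤ ((d : ℝ) + 1) / 2) := by
  have hinf : Infinite k := IsAlgClosed.instInfinite
  have key : PlaneCurve.bourbakiDegree d f = 2 → (e : ℤ) ≤ d - e + 1 ∧
      PlaneCurve.HasMinimalGradedFreeResolution (PlaneCurve.gradientIdeal f) ![0]
        ![(d : ℤ), (d : ℤ), (d : ℤ)]
        ![(d : ℤ) + (d - e + 2), (d : ℤ) + (d - e + 1), (d : ℤ) + e]
        ![(d : ℤ) + (d - e + 3)] := by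
    intro h
    have hmem := Nat.sInf_mem (Nat.nonempty_of_sInf_eq_succ h)
    rw [show sInf _ = 2 from h] at hmem
    obtain ⟨ε, I, hε, hεe, hB, hdeg⟩ := hmem
    rw [← he] at hεe hB
    exact hB.resolution hf he hε hεe (by exact_mod_cast hdeg)
  refine ⟨⟨fun h => (key h).2, fun h => ?_⟩, fun h => ?_⟩
  · obtain ⟨P'⟩ := PlaneCurve.exists_syzPresentation hf h
    have hb : (fun i => (![(d : ℤ) + (d - e + 2), (d : ℤ) + (d - e + 1), (d : ℤ) + e] :
        Fin 3 → ℤ) i - d) = ![(d : ℤ) - e + 2, d - e + 1, e] := by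
      funext i
      fin_cases i <;> simp
    have hc : (![(d : ℤ) + (d - e + 3)] : Fin 1 → ℤ) 0 - d = d - e + 3 := by simp
    rw [hb, hc] at P'
    have hed : (e : ℤ) ≤ d - e + 1 := he ▸ P'.indegSyz_le_degree 1
    have hall : ∀ n ∈ {n : ℕ | ∃ (ε : PlaneCurve.syz f) (I : Ideal (PlaneCurve.PolyRing k)),
        ε ≠ 0 ∧ (ε : Fin 3 → PlaneCurve.PolyRing k) ∈
          PlaneCurve.freePiece (k := k) (0 : Fin 3 → ℤ) (PlaneCurve.indegSyz f) ∧
        PlaneCurve.IsBourbakiIdeal d (PlaneCurve.indegSyz f) f ε I ∧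
        PlaneCurve.degQuot I = n}, n = 2 := by
      rintro n ⟨ε, I, hε, hεe, hB, hn⟩
      rw [← he] at hεe hB
      have := P'.degQuot_eq_two hed hε hεe hB
      exact_mod_cast hn.symm.trans this
    refine hall _ (Nat.sInf_mem ⟨2, P'.gen 2, Ideal.span {P'.rel 0, P'.rel 1},
      P'.gen_ne_zero 2, ?_, ?_, ?_⟩)
    · exact he ▸ P'.gen_mem 2
    · exact he ▸ P'.isBourbakiIdeal hf he
    · exact_mod_cast P'.degQuot_eq_two hed (P'.gen_ne_zero 2) (P'.gen_mem 2)
        (P'.isBourbakiIdeal hf he)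
  · have h1 := (key h).1
    have h2 : (e : ℝ) ≤ (d : ℝ) - e + 1 := by exact_mod_cast h1
    linarith
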